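/- **Model.** Let $K,F,T$ be integers with $K\ge 1$, $F\ge 0$, $T\ge 1$. There are $K$ nodes and $N$ files $w_1,\dots,w_N\in\{0,1\}^F$. Map functions $g_{q,n}:\{0,1\}^F\to\{0,1\}^T$ ($q\in[K]$, $n\in[N]$) define the intermediate values (IVAs) $v_{q,n}=g_{q,n}(w_n)$; node $k$ needs $v_{k,1},\dots,v_{k,N}$ to evaluate its own output (reduce) function. A *map-shuffle-reduce procedure* consists of: for each node $k$, a set $\mathcal M_k\subseteq[N]$ of stored files and sets $\Lambda_{k,n}\subseteq[K]$ for $n\in\mathcal M_k$, so that node $k$ computes exactly the IVAs $\mathcal C_k=\{v_{q,n}: n\in\mathcal M_k,\ q\in\Lambda_{k,n}\}$ (counted by their index pairs $(q,n)$); a length $l_k\in\mathbb N$ and an encoding function $\varphi_k$ giving the signal $X_k=\varphi_k(\mathcal C_k)\in\{0,1\}^{l_k}$, which is delivered without error to all nodes; and a decoding function $\psi_k$. It is required that $\psi_k(X_1,\dots,X_K,\mathcal C_k)=(v_{k,1},\dots,v_{k,N})$ for every node $k$, for all choices of the map functions and all files; the procedure itself does not depend on the map functions or the files. Its storage space, computation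 load and communication load are $$\frac{\sum_k|\mathcal M_k|}{N},\qquad \frac{\sum_k|\mathcal C_k|}{NK},\qquad \frac{\sum_k l_k}{NKT}.$$ A triple $(r,c,L)$ of real numbers is *achievable* if for every $\epsilon>0$ and all sufficiently large $N$ there is a procedure whose storage space, computation load and communication load are at most $r+\epsilon$, $c+\epsilon$ and $L+\epsilon$, respectively. The optimal communication load is $L^*(r,c)=\inf\{L:(r,c,L)\text{ is achievable}\}$. For $r\in[1,K)$ put $$g_r=\lfloor r\rfloor+\frac{(r-\lfloor r\rfloor)(K-\lceil r\rceil)}{K-r},\qquad c^*(r)=\frac rK+\Big(1-\frac rK\Big)g_r,\qquad L^*(r)=\frac{\lfloor r\rfloor+\lceil r\rceil-r}{\lfloor r\rfloor\lceil r\rceil}-\frac1K .$$ **Theorem.** Let $r\in[1,K)$. For $1\le c\le r$ the set of $L$ such that $(r,c,L)$ is achievable is non-empty and bounded below, and the following hold. 1. If $c=\frac rK+\left(1-\frac rK\right)g$ for some $g\in\{1,\dots,\lfloor r\rfloor\}$, then $$L^*(r,c)=\frac{1}{c-r/K}\Big(1-\frac rK\Big)^2 .$$ 2. For every $c$ with $1\le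 c\le c^*(r)$, $L^*(r,c)$ is the value at $c$ of the lower convex envelope of the finitely many points $\big(c',\frac{1}{c'-r/K}(1-\frac rK)^2\big)$, where $c'=\frac rK+\left(1-\frac rK\right)g$ and $g=1,\dots,\lfloor r\rfloor$, together with the point $(c^*(r),L^*(r))$. (The lower convex envelope at $x$ of a finite set $A\subset\mathbb R^2$ is the least $y$ such that $(x,y)$ lies in the convex hull of $A$.) 3. For every $c$ with $c^*(r)\le c\le r$, $L^*(r,c)=L^*(r)$. -/

import Mathlib

/-- Bit strings of length `n`, that is, the set `𝔽_{2^n}` seen as the `n`-dimensional vector space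
over the field with two elements. -/
abbrev Bits (n : ℕ) : Type := Fin n → ZMod 2

/-- The intermediate values (IVAs) `v_{q,n} = g_{q,n}(w_n)` given by the map functions `g` and the
files `w`. -/
def iva {K N F T : ℕ} (g : Fin K → Fin N → Bits F → Bits T) (w : Fin N → Bits F)
    (q : Fin K) (n : Fin N) : Bits T :=
  g q n (w n)

/-- The index pairs `(q, n)` of the IVAs `v_{q,n}` computed by a node that stores the files with
indices in `M` and computes from each stored file `w_n` the IVAs `v_{q,n}` with `q ∈ Λ n`. -/
def computedIVAs {K N : ℕ} (M : Finset (Fin N)) (Λ : Fin N → Finset (Fin K)) :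
    Finset (Fin K × Fin N) :=
  Finset.univ.filter fun p => p.2 ∈ M ∧ p.1 ∈ Λ p.2

/-- A map-shuffle-reduce procedure for `K` nodes, `N` files and IVAs of `T` bits. -/
structure Procedure (K N T : ℕ) where
  /-- `store k`: the (indices of the) files stored at node `k`. -/
  store : Fin K → Finset (Fin N)
  /-- `sel k n`: the indices `q` of the IVAs `v_{q,n}` that node `k` computes from the file `w_n`
  if it stores that file. -/
  sel : Fin K → Fin N → Finset (Fin K)
  /-- `len k`: the number of bits of the signal multicast by node `k`. -/
  len : Fin K → ℕ
  /-- The signal of node `k` is a function of the IVAs that node `k` has computed. -/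
  encode : ∀ k : Fin K,
    ({p // p ∈ computedIVAs (store k) (sel k)} → Bits T) → Bits (len k)
  /-- Node `k` decodes from all the signals and the IVAs that it has computed itself. -/
  decode : ∀ k : Fin K, (∀ i : Fin K, Bits (len i)) →
    ({p // p ∈ computedIVAs (store k) (sel k)} → Bits T) → Fin N → Bits T

namespace Procedure

variable {K N T : ℕ}

/-- The index pairs of the IVAs computed at node `k`. -/
def computed (P : Procedure K N T) (k : Fin K) : Finset (Fin K × Fin N) :=
  computedIVAs (P.store k) (P.sel k)

/-- The values of the IVAs computed at node `k`, when the IVAs are `v`. -/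
def localIVAs (P : Procedure K N T) (v : Fin K → Fin N → Bits T) (k : Fin K) :
    {p // p ∈ computedIVAs (P.store k) (P.sel k)} → Bits T :=
  fun p => v p.1.1 p.1.2

/-- The signal multicast by node `k`, when the IVAs are `v`. -/
def signal (P : Procedure K N T) (v : Fin K → Fin N → Bits T) (k : Fin K) : Bits (P.len k) :=
  P.encode k (P.localIVAs v k)

/-- The procedure works for files of `F` bits: for all map functions and all files, every node `k`
restores all the IVAs `v_{k,1}, …, v_{k,N}` that its reduce function takes as arguments. -/
def IsValid (P : Procedure K N T) (F : ℕ) : Prop :=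
  ∀ (g : Fin K → Fin N → Bits F → Bits T) (w : Fin N → Bits F) (k : Fin K),
    P.decode k (P.signal (iva g w)) (P.localIVAs (iva g w) k) = iva g w k

/-- The storage space: number of stored files, normalised by `N`. -/
noncomputable def storageSpace (P : Procedure K N T) : ℝ :=
  (∑ k : Fin K, ((P.store k).card : ℝ)) / N

/-- The computation load: number of computed IVAs, normalised by `N * K`. -/
noncomputable def computationLoad (P : Procedure K N T) : ℝ :=
  (∑ k : Fin K, ((P.computed k).card : ℝ)) / (N * K)

/-- The communication load: number of multicast bits, normalised by `N * K * T`. -/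
noncomputable def communicationLoad (P : Procedure K N T) : ℝ :=
  (∑ k : Fin K, (P.len k : ℝ)) / (N * K * T)

end Procedure

/-- The storage-computation-communication triple `(r, c, L)` is achievable with `K` nodes, files of
`F` bits and IVAs of `T` bits. -/
def Achievable (K F T : ℕ) (r c L : ℝ) : Prop :=
  ∀ ε : ℝ, 0 < ε → ∃ N₀ : ℕ, ∀ N : ℕ, N₀ ≤ N → ∃ P : Procedure K N T, P.IsValid F ∧
    P.storageSpace ≤ r + ε ∧ P.computationLoad ≤ c + ε ∧ P.communicationLoad ≤ L + ε

/-- The optimal communication load `L*(r, c)`. -/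
noncomputable def optimalLoad (K F T : ℕ) (r c : ℝ) : ℝ :=
  sInf {L : ℝ | Achievable K F T r c L}

/-- The computation load `r/K + (1 - r/K) g`. -/
noncomputable def loadPoint (K : ℕ) (r g : ℝ) : ℝ :=
  r / K + (1 - r / K) * g

/-- The load `L = (1 - r/K)² / (c - r/K)`. -/
noncomputable def cornerLoad (K : ℕ) (r c : ℝ) : ℝ :=
  1 / (c - r / K) * (1 - r / K) ^ 2

/-- `g_r = ⌊r⌋ + (r - ⌊r⌋)(K - ⌈r⌉)/(K - r)`. -/
noncomputable def gStar (K : ℕ) (r : ℝ) : ℝ :=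
  (⌊r⌋ : ℝ) + (r - (⌊r⌋ : ℝ)) * ((K : ℝ) - (⌈r⌉ : ℝ)) / ((K : ℝ) - r)

/-- `c*(r) = r/K + (1 - r/K) g_r`. -/
noncomputable def cStar (K : ℕ) (r : ℝ) : ℝ :=
  loadPoint K r (gStar K r)

/-- `L*(r) = (⌊r⌋ + ⌈r⌉ - r)/(⌊r⌋⌈r⌉) - 1/K`. -/
noncomputable def LStar (K : ℕ) (r : ℝ) : ℝ :=
  ((⌊r⌋ : ℝ) + (⌈r⌉ : ℝ) - r) / ((⌊r⌋ : ℝ) * (⌈r⌉ : ℝ)) - 1 / (K : ℝ)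

/-- The points `(c, (1 - r/K)² / (c - r/K))` with `c = r/K + (1 - r/K) g`, `g = 1, …, ⌊r⌋`. -/
def cornerPoints (K : ℕ) (r : ℝ) : Set (ℝ × ℝ) :=
  {p | ∃ g : ℕ, 1 ≤ g ∧ (g : ℤ) ≤ ⌊r⌋ ∧
    p = (loadPoint K r g, cornerLoad K r (loadPoint K r g))}

/-- The lower convex envelope at `x` of a set of points in the plane. -/
noncomputable def lowerConvexEnvelope (A : Set (ℝ × ℝ)) (x : ℝ) : ℝ :=
  sInf {y : ℝ | (x, y) ∈ convexHull ℝ A}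

/-! Both directions reduce to counting, for each IVA, the number `a` of nodes that compute it.

Converse: an entropy argument shows that the total length is at least `T` times the sum of `1 / a`
over the IVAs not computed by the node that needs them (`Procedure.Decodes.sum_invMultiplicity_le`).
On integers, `1 / a` lies above the line that interpolates it at `g` and `g + 1`; summing this
affine bound puts the region above the line `chordLoad` (`Achievable.chordLoad_le`). Since `a` is at
most the number `m` of nodes that store the file, the same lines for `1 / m` bound the load in terms
of the storage alone (`Achievable.storage_bound`).

Achievability: if each file is stored at `m` nodes and its missing IVAs are computed at `t ≤ m` of
them, one coded signal of `T` bits serves `t` nodes, so the load is `(1 - m / K) / t`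
(`realizable_of_le`). Time sharing between `m = ⌊r⌋` and `m = ⌊r⌋ + 1` gives the corner points if
`t` is kept fixed, and the point `(c*(r), L*(r))` if `t = m`. These points lie on the lines of the
converse, so the bounds meet. -/

/-! ### Procedures as functions of the IVAs -/

namespace Procedure

variable {K N T : ℕ}

/-- Every node restores the IVAs that it needs, whatever the values of the IVAs are. -/
def Decodes (P : Procedure K N T) : Prop :=
  ∀ (v : Fin K → Fin N → Bits T) (k : Fin K),
    P.decode k (P.signal v) (P.localIVAs v k) = v k

theorem Decodes.isValid {P : Procedure K N T} (h : P.Decodes) (F : ℕ) : P.IsValid F :=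
  fun g w k => h (iva g w) k

/-- Map functions that ignore the files already produce every array of IVAs, so `F` plays no role.
-/
theorem IsValid.decodes {P : Procedure K N T} {F : ℕ} (h : P.IsValid F) : P.Decodes :=
  fun v k => h (fun q n _ => v q n) (fun _ => 0) k

theorem mem_computed {P : Procedure K N T} {k : Fin K} {p : Fin K × Fin N} :
    p ∈ P.computed k ↔ p.2 ∈ P.store k ∧ p.1 ∈ P.sel k p.2 := by
  simp [computed, computedIVAs]

theorem localIVAs_congr {P : Procedure K N T} {v v' : Fin K → Fin N → Bits T} {k : Fin K}
    (h : ∀ p ∈ P.computed k, v p.1 p.2 = v' p.1 p.2) : P.localIVAs v k = P.localIVAs v' k :=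
  funext fun p => h p.1 p.2

theorem signal_congr {P : Procedure K N T} {v v' : Fin K → Fin N → Bits T} {k : Fin K}
    (h : ∀ p ∈ P.computed k, v p.1 p.2 = v' p.1 p.2) : P.signal v k = P.signal v' k := by
  rw [signal, signal, localIVAs_congr h]

theorem Decodes.eq_of_agree {P : Procedure K N T} (hP : P.Decodes)
    {v v' : Fin K → Fin N → Bits T} {k : Fin K}
    (h : ∀ p ∈ P.computed k, v p.1 p.2 = v' p.1 p.2)
    (hs : ∀ i, P.signal v i = P.signal v' i) : v k = v' k := by
  rw [← hP v k, ← hP v' k, localIVAs_congr h, funext hs]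

end Procedure

/-! ### Construction of procedures -/

/-- There is a procedure for `N` files with `s` stored files, `c` computed IVAs and `l` multicast
bits in total. -/
def Realizable (K T N s c l : ℕ) : Prop :=
  ∃ P : Procedure K N T, P.Decodes ∧ ∑ k, (P.store k).card = s ∧
    ∑ k, (P.computed k).card = c ∧ ∑ k, P.len k = l

/-- A procedure for files and signal bits indexed by arbitrary finite types: it suffices that the
signals depend only on the computed IVAs and that signals and computed IVAs determine the
IVAs that are needed. -/
theorem realizable_of_fintype {K T : ℕ} {ι : Type*} [Fintype ι] {σ : Fin K → Type*}
    [∀ k, Fintype (σ k)] (M : Fin K → Finset ι) (C : Fin K → Finset (Fin K × ι))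
    (hC : ∀ k, ∀ p ∈ C k, p.2 ∈ M k)
    (X : ∀ k, (Fin K → ι → Bits T) → σ k → ZMod 2)
    (hX : ∀ k v v', (∀ p ∈ C k, v p.1 p.2 = v' p.1 p.2) → X k v = X k v')
    (hdec : ∀ k v v', (∀ p ∈ C k, v p.1 p.2 = v' p.1 p.2) → (∀ i, X i v = X i v') →
      v k = v' k) :
    Realizable K T (Fintype.card ι) (∑ k, (M k).card) (∑ k, (C k).card)
      (∑ k, Fintype.card (σ k)) := by
  classical
  let e := Fintype.equivFin ι
  let M' : Fin K → Finset (Fin (Fintype.card ι)) := fun k => (M k).map e.toEmbedding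
  let sel : Fin K → Fin (Fintype.card ι) → Finset (Fin K) :=
    fun k n => Finset.univ.filter fun q => (q, e.symm n) ∈ C k
  have hmem : ∀ k p, p ∈ computedIVAs (M' k) (sel k) ↔ (p.1, e.symm p.2) ∈ C k := by
    intro k p
    simp only [computedIVAs, M', sel, Finset.mem_filter, Finset.mem_univ, true_and,
      Finset.mem_map_equiv, and_iff_right_iff_imp]
    exact fun h => hC k _ h
  -- Padding by `0` is harmless: by `hX` a signal sees only the entries in `C k`.
  let extend : ∀ k, ({p // p ∈ computedIVAs (M' k) (sel k)} → Bits T) → Fin K → ι → Bits T :=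
    fun k c q n => if h : (q, e n) ∈ computedIVAs (M' k) (sel k) then c ⟨_, h⟩ else 0
  let enc : ∀ k, ({p // p ∈ computedIVAs (M' k) (sel k)} → Bits T) →
      Bits (Fintype.card (σ k)) :=
    fun k c i => X k (extend k c) ((Fintype.equivFin (σ k)).symm i)
  let loc : (Fin K → Fin (Fintype.card ι) → Bits T) → ∀ k,
    {p // p ∈ computedIVAs (M' k) (sel k)} → Bits T := fun v _ p => v p.1.1 p.1.2
  have hext : ∀ v k, X k (extend k (loc v k)) = X k (fun q n => v q (e n)) := by
    intro v k
    refine hX k _ _ fun p hp => ?_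
    have : (p.1, e p.2) ∈ computedIVAs (M' k) (sel k) := by
      rw [hmem]; simpa using hp
    simp [extend, loc, this]
  -- The decoder picks any array of IVAs consistent with its observations; `hdec` makes the choice
  -- irrelevant.
  let dec : ∀ k, (∀ i, Bits (Fintype.card (σ i))) →
      ({p // p ∈ computedIVAs (M' k) (sel k)} → Bits T) → Fin (Fintype.card ι) → Bits T :=
    fun k x c => if h : ∃ v : Fin K → Fin (Fintype.card ι) → Bits T,
      loc v k = c ∧ (fun i => enc i (loc v i)) = x then h.choose k else 0
  refine ⟨⟨M', sel, fun k => Fintype.card (σ k), enc, dec⟩, ?_, ?_, ?_, rfl⟩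
  · intro v k
    have h : ∃ v' : Fin K → Fin (Fintype.card ι) → Bits T,
      loc v' k = loc v k ∧ (fun i => enc i (loc v' i)) = fun i => enc i (loc v i) :=
      ⟨v, rfl, rfl⟩
    suffices h.choose k = v k from (dif_pos h).trans this
    obtain ⟨h1, h2⟩ := h.choose_spec
    have key := hdec k (fun q n => h.choose q (e n)) (fun q n => v q (e n)) ?_ ?_
    · funext n
      simpa using congrFun key (e.symm n)
    · intro p hp
      have hp' : (p.1, e p.2) ∈ computedIVAs (M' k) (sel k) := by
        rw [hmem]; simpa using hp
      exact congrFun h1 ⟨_, hp'⟩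
    · intro i
      rw [← hext, ← hext]
      funext j
      have := congrFun (congrFun h2 i) (Fintype.equivFin (σ i) j)
      simpa [enc] using this
  · simp [M']
  · refine Finset.sum_congr rfl fun k _ => ?_
    refine Finset.card_equiv ((Equiv.refl _).prodCongr e.symm) fun p => ?_
    exact hmem k p

theorem Realizable.add {K T N₁ s₁ c₁ l₁ N₂ s₂ c₂ l₂ : ℕ} (h₁ : Realizable K T N₁ s₁ c₁ l₁)
    (h₂ : Realizable K T N₂ s₂ c₂ l₂) :
    Realizable K T (N₁ + N₂) (s₁ + s₂) (c₁ + c₂) (l₁ + l₂) := by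
  obtain ⟨P, hP, rfl, rfl, rfl⟩ := h₁
  obtain ⟨Q, hQ, rfl, rfl, rfl⟩ := h₂
  have := realizable_of_fintype (K := K) (T := T) (ι := Fin N₁ ⊕ Fin N₂)
    (σ := fun k => Fin (P.len k) ⊕ Fin (Q.len k))
    (fun k => (P.store k).disjSum (Q.store k))
    (fun k => ((P.computed k).disjSum (Q.computed k)).map
      (Equiv.prodSumDistrib _ _ _).symm.toEmbedding) ?_
    (fun k v => Sum.elim (P.signal (fun q n => v q (Sum.inl n)) k)
      (Q.signal (fun q n => v q (Sum.inr n)) k)) ?_ ?_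
  · simpa [Finset.sum_add_distrib] using this
  · rintro k ⟨q, n | n⟩ hp
    · simp [Finset.mem_map_equiv] at hp
      simpa using (Procedure.mem_computed.1 hp).1
    · simp [Finset.mem_map_equiv] at hp
      simpa using (Procedure.mem_computed.1 hp).1
  · intro k v v' h
    congr 1
    · exact Procedure.signal_congr fun p hp => h (p.1, Sum.inl p.2)
        (by simpa [Finset.mem_map_equiv] using hp)
    · exact Procedure.signal_congr fun p hp => h (p.1, Sum.inr p.2)
        (by simpa [Finset.mem_map_equiv] using hp)
  · intro k v v' h hs
    have h1 := hP.eq_of_agree (v := fun q n => v q (Sum.inl n))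
      (v' := fun q n => v' q (Sum.inl n)) (k := k)
      (fun p hp => h (p.1, Sum.inl p.2) (by simpa [Finset.mem_map_equiv] using hp))
      (fun i => (Sum.elim_eq_iff.1 (hs i)).1)
    have h2 := hQ.eq_of_agree (v := fun q n => v q (Sum.inr n))
      (v' := fun q n => v' q (Sum.inr n)) (k := k)
      (fun p hp => h (p.1, Sum.inr p.2) (by simpa [Finset.mem_map_equiv] using hp))
      (fun i => (Sum.elim_eq_iff.1 (hs i)).2)
    funext n
    cases n with
    | inl n => exact congrFun h1 n
    | inr n => exact congrFun h2 n

/-- All nodes store all the files and compute the IVAs that they need. -/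
theorem realizable_no_communication (K T b : ℕ) : Realizable K T b (b * K) (b * K) 0 := by
  have := realizable_of_fintype (K := K) (T := T) (ι := Fin b) (σ := fun _ => Empty)
    (fun _ => Finset.univ) (fun k => {k} ×ˢ Finset.univ) (by simp)
    (fun _ _ => Empty.elim) (by simp) ?_
  · simpa [mul_comm] using this
  · intro k v v' h _
    funext n
    exact h (k, n) (by simp)

theorem Realizable.mul {K T N s c l : ℕ} (h : Realizable K T N s c l) (a : ℕ) :
    Realizable K T (a * N) (a * s) (a * c) (a * l) := by
  induction a with
  | zero => simpa using realizable_no_communication K T 0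
  | succ a ih => simpa only [Nat.succ_mul] using ih.add h

open Equiv in
/-- Files are indexed by orders `π` of the nodes, with `t` copies each. The file `(π, i)` is stored
at the first `m` nodes; the first `t` nodes compute from it the IVAs for the last `K - m` nodes. -/
theorem realizable_of_le {K : ℕ} (T : ℕ) {m t : ℕ} (htm : t ≤ m) (hmK : m ≤ K) :
    Realizable K T (Fintype.card (Perm (Fin K) × Fin t))
      (Fintype.card (Perm (Fin K) × Fin t) * m)
      (Fintype.card (Perm (Fin K) × Fin t) * (m + (K - m) * t))
      (Fintype.card (Perm (Fin K)) * (K - m) * T) := by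
  classical
  let low : Finset (Fin K) := Finset.univ.filter fun x => x.1 < t
  have hcount : ∀ a ≤ K, (Finset.univ.filter fun x : Fin K => x.1 < a).card = a := by
    intro a ha
    rw [Fin.card_filter_val_lt]; omega
  have hcount' : (Finset.univ.filter fun x : Fin K => m ≤ x.1).card = K - m := by
    have := Finset.card_filter_add_card_filter_not (s := Finset.univ) fun x : Fin K => x.1 < m
    rw [hcount m hmK] at this
    simp only [not_lt, Finset.card_univ, Fintype.card_fin] at this
    omega
  have hlow : low.card = t := hcount t (htm.trans hmK)
  -- Rotating the `t + 1` positions `p` and `0, …, t - 1` links the orders whose IVAs are coded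
  -- together.
  have hcyc : ∀ p : Fin K, ∃ c : Perm (Fin K), m ≤ p.1 → c.IsCycleOn (insert p low : Finset _) :=
    fun p => (Finset.exists_cycleOn (insert p low)).imp fun c hc _ => hc.1
  choose c hc using hcyc
  have hcard : ∀ p : Fin K, m ≤ p.1 → (insert p low).card = t + 1 := by
    intro p hp
    rw [Finset.card_insert_of_notMem, hlow]
    simp [low]; omega
  -- The cycle has length `t + 1`: only multiples of it return `p` to itself, all other powers land
  -- among the first `t` positions.
  have hlt : ∀ p : Fin K, m ≤ p.1 → ∀ j : ℤ, ¬ ((t : ℤ) + 1 ∣ j) → ((c p ^ j) p).1 < t := by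
    intro p hp j hj
    have h1 : (c p ^ j) p ∈ insert p low := by
      have := ((hc p hp).1.perm_zpow j).mapsTo (Finset.mem_coe.2 (Finset.mem_insert_self p low))
      exact_mod_cast this
    rcases Finset.mem_insert.1 h1 with h | h
    · rw [(hc p hp).zpow_apply_eq (Finset.mem_insert_self p low), hcard p hp] at h
      exact absurd (by exact_mod_cast h) hj
    · simpa [low] using h
  -- Term `i` is the IVA wanted by the node at position `p` of the order `π * c p ^ (i + 1)`. The
  -- `t` copies of each file replace a splitting of IVAs into `t` pieces, so `t` need not divide
  -- `T`.
  let sgn : Perm (Fin K) → Fin K → (Fin K → Perm (Fin K) × Fin t → Bits T) → Fin t → Bits T :=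
    fun π p v i => v (π ((c p ^ ((i : ℤ) + 1)) p)) (π * c p ^ ((i : ℤ) + 1), i)
  have := realizable_of_fintype (K := K) (T := T) (ι := Perm (Fin K) × Fin t)
    (σ := fun k => {x : Perm (Fin K) × Fin K // m ≤ x.2.1 ∧ x.1 x.2 = k} × Fin T)
    (fun k => Finset.univ.filter fun n => (n.1⁻¹ k).1 < m)
    (fun k => Finset.univ.filter fun x => (x.1 = k ∧ (x.2.1⁻¹ k).1 < m) ∨
      ((x.2.1⁻¹ k).1 < t ∧ m ≤ (x.2.1⁻¹ x.1).1))
    ?_ (fun k v s => (∑ i : Fin t, sgn s.1.1.1 s.1.1.2 v i) s.2) ?_ ?_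
  · convert this using 1
    · simp only [Finset.card_filter]
      rw [Finset.sum_comm, Finset.sum_congr rfl (g := fun _ => m)]
      · simp
      · intro n _
        rw [Equiv.sum_comp n.1⁻¹ (fun x => if x.1 < m then 1 else 0), ← Finset.card_filter,
          hcount m hmK]
    · simp only [Finset.card_filter]
      simp only [Fintype.sum_prod_type_right (α₂ := Perm (Fin K) × Fin t)]
      rw [Finset.sum_comm, Finset.sum_congr rfl (g := fun _ => m + (K - m) * t)]
      · simp only [Finset.sum_const, Finset.card_univ, smul_eq_mul]
      · intro n _
        -- Counting by positions: own IVAs and those for the last `K - m` positions are disjoint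
        -- because `t ≤ m`.
        have h1 : ∀ x y : Fin K, (if (y = x ∧ x.1 < m) ∨ (x.1 < t ∧ m ≤ y.1) then 1 else 0) =
            (if y = x then if x.1 < m then 1 else 0 else 0) +
              (if x.1 < t then 1 else 0) * (if m ≤ y.1 then 1 else 0) := by
          intro x y
          by_cases hxy : y = x
          · subst hxy
            by_cases h1 : y.1 < m
            · simp [h1]
            · have : ¬ y.1 < t := by omega
              simp [h1, this]
          · by_cases h1 : x.1 < t <;> by_cases h2 : m ≤ y.1 <;> simp [hxy, h1, h2]
        calc _ = ∑ x : Fin K, ∑ y : Fin K,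
              (if (y = x ∧ x.1 < m) ∨ (x.1 < t ∧ m ≤ y.1) then 1 else 0) := by
              symm
              rw [← Equiv.sum_comp n.1⁻¹]
              refine Finset.sum_congr rfl fun k _ => ?_
              rw [← Equiv.sum_comp n.1⁻¹]
              refine Finset.sum_congr rfl fun q _ => ?_
              simp only [EmbeddingLike.apply_eq_iff_eq]
          _ = m + t * (K - m) := by
              simp only [h1, Finset.sum_add_distrib, ← Finset.sum_mul_sum]
              simp only [Finset.sum_ite_eq', Finset.mem_univ, if_true, Finset.sum_boole,
                hcount m hmK, hcount t (htm.trans hmK), hcount', Nat.cast_id]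
          _ = m + (K - m) * t := by rw [mul_comm t]
    · simp only [Fintype.card_prod, Fintype.card_fin, ← Finset.sum_mul, Fintype.card_subtype]
      congr 1
      simp only [Finset.card_filter]
      rw [Finset.sum_comm, Fintype.sum_prod_type]
      simp only [ite_and]
      simp only [Finset.sum_ite_irrel, Finset.sum_ite_eq, Finset.mem_univ, if_true,
        Finset.sum_const_zero, Finset.sum_boole, hcount', Nat.cast_id]
      simp
  · intro k x hx
    simp only [Finset.mem_filter, Finset.mem_univ, true_and] at hx ⊢
    omega
  · intro k v v' h
    funext ⟨⟨⟨π, p⟩, hp, hk⟩, b⟩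
    dsimp only at hp hk ⊢
    refine congrFun (Finset.sum_congr rfl fun i _ => ?_) b
    refine h (π ((c p ^ ((i : ℤ) + 1)) p), (π * c p ^ ((i : ℤ) + 1), i)) ?_
    simp only [Finset.mem_filter, Finset.mem_univ, true_and]
    right
    subst hk
    constructor
    -- In the order of term `i` the sender `π p` occupies position `c p ^ (-(i + 1))` of `p`, one of
    -- the first `t`.
    · have := hlt p hp (-((i : ℤ) + 1)) ?_
      · have e : (π * c p ^ ((i : ℤ) + 1))⁻¹ (π p) = (c p ^ (-((i : ℤ) + 1))) p := by
          have : (π * c p ^ ((i : ℤ) + 1))⁻¹ * π = c p ^ (-((i : ℤ) + 1)) := by group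
          rw [← this]; rfl
        rw [e]
        exact this
      · intro hd
        have := Int.eq_zero_of_abs_lt_dvd hd (by rw [abs_lt]; omega)
        omega
    · simpa using hp
  · intro k v v' h hs
    funext ⟨π', i⟩
    by_cases hk : (π'⁻¹ k).1 < m
    · exact h (k, (π', i)) (Finset.mem_filter.2 ⟨Finset.mem_univ _, Or.inl ⟨rfl, hk⟩⟩)
    set p := π'⁻¹ k with hpdef
    have hp : m ≤ p.1 := not_lt.1 hk
    -- Undoing the rotation finds the signal whose term `i` is the wanted IVA.
    set π : Perm (Fin K) := π' * (c p ^ ((i : ℤ) + 1))⁻¹ with hπ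
    have hpk : π' p = k := by simp [hpdef]
    have hsum : ∑ j, sgn π p v j = ∑ j, sgn π p v' j := by
      funext b
      exact congrFun (hs (π p)) (⟨⟨(π, p), hp, rfl⟩, b⟩)
    -- In the order of term `j`, node `k` occupies position `c p ^ (i - j)` of `p`, so it computes
    -- every term except its own and can cancel them.
    have hrest : ∀ j ≠ i, sgn π p v j = sgn π p v' j := by
      intro j hj
      refine h (π ((c p ^ ((j : ℤ) + 1)) p), (π * c p ^ ((j : ℤ) + 1), j)) ?_
      simp only [Finset.mem_filter, Finset.mem_univ, true_and]
      right
      constructor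
      · have := hlt p hp ((i : ℤ) - j) ?_
        · rw [← hpk]
          have e : (π * c p ^ ((j : ℤ) + 1))⁻¹ (π' p) = (c p ^ ((i : ℤ) - j)) p := by
            have : (π * c p ^ ((j : ℤ) + 1))⁻¹ * π' = c p ^ ((i : ℤ) - j) := by
              rw [hπ]
              group
            rw [← this]; rfl
          rw [e]
          exact this
        · intro hd
          have := Int.eq_zero_of_abs_lt_dvd hd (by rw [abs_lt]; omega)
          apply hj
          ext
          omega
      · simpa using hp
    have hi : sgn π p v i = sgn π p v' i := by
      rw [← Finset.add_sum_erase _ _ (Finset.mem_univ i),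
        ← Finset.add_sum_erase _ (sgn π p v') (Finset.mem_univ i),
        Finset.sum_congr rfl fun j hj => hrest j (Finset.ne_of_mem_erase hj)] at hsum
      exact add_right_cancel hsum
    have e1 : π * c p ^ ((i : ℤ) + 1) = π' := by simp [hπ]
    have e2 : π ((c p ^ ((i : ℤ) + 1)) p) = k := by
      rw [← hpk, ← e1]; rfl
    simp only [sgn, e1, e2] at hi
    exact hi

/-! ### Shannon entropy of partitions of a finite set -/

section PartitionEntropy

variable {Ω : Type*} [Fintype Ω]

open scoped Classical in
/-- The number of elements of the class of `ω`. -/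
noncomputable def Setoid.classCard (r : Setoid Ω) (ω : Ω) : ℕ :=
  (Finset.univ.filter fun ω' => r ω ω').card

theorem Setoid.classCard_pos (r : Setoid Ω) (ω : Ω) : 0 < r.classCard ω := by
  classical
  exact Finset.card_pos.2 ⟨ω, by simp⟩

theorem Setoid.classCard_mono {r s : Setoid Ω} (h : r ≤ s) (ω : Ω) :
    r.classCard ω ≤ s.classCard ω := by
  classical
  refine Finset.card_le_card fun ω' h' => ?_
  simp only [Finset.mem_filter, Finset.mem_univ, true_and] at h' ⊢
  exact h h'

theorem Setoid.classCard_congr (r : Setoid Ω) {ω ω' : Ω} (h : r ω ω') :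
    r.classCard ω = r.classCard ω' := by
  classical
  unfold Setoid.classCard
  congr 1
  ext a
  simp only [Finset.mem_filter, Finset.mem_univ, true_and]
  exact ⟨fun h' => r.trans (r.symm h) h', fun h' => r.trans h h'⟩

/-- The Shannon entropy of the class of a uniformly distributed element. -/
noncomputable def Setoid.entropy (r : Setoid Ω) : ℝ :=
  Real.log (Fintype.card Ω) - (∑ ω, Real.log (r.classCard ω)) / Fintype.card Ω

/-- In the order on `Setoid`, smaller means finer, that is, more informative; `⊓` is joint
observation. -/
theorem Setoid.entropy_anti {r s : Setoid Ω} (h : r ≤ s) : s.entropy ≤ r.entropy := by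
  unfold Setoid.entropy
  gcongr with ω
  · exact_mod_cast r.classCard_pos ω
  · exact Setoid.classCard_mono h ω

/-- All nonzero terms come from one class, and there are at most as many of them as the class has
elements. -/
theorem Setoid.sum_ite_inv_classCard_le (r : Setoid Ω) (p : Ω → Prop) [DecidablePred p]
    (hp : ∀ ω ω', p ω → p ω' → r ω ω') :
    ∑ ω, (if p ω then ((r.classCard ω : ℝ))⁻¹ else 0) ≤ 1 := by
  classical
  by_cases h : ∃ ω, p ω
  · obtain ⟨ω₀, h₀⟩ := h
    have hpos : (0 : ℝ) < r.classCard ω₀ := by exact_mod_cast r.classCard_pos ω₀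
    calc ∑ ω, (if p ω then ((r.classCard ω : ℝ))⁻¹ else 0)
        ≤ ∑ ω, (if r ω₀ ω then ((r.classCard ω₀ : ℝ))⁻¹ else 0) := by
          refine Finset.sum_le_sum fun ω _ => ?_
          by_cases hω : p ω
          · have := hp _ _ h₀ hω
            rw [if_pos hω, if_pos this, r.classCard_congr this]
          · rw [if_neg hω]
            positivity
      _ = 1 := by
          rw [← Finset.sum_filter, Finset.sum_const, nsmul_eq_mul]
          exact mul_inv_cancel₀ hpos.ne'
  · push Not at h
    simp [h]

/-- The product of class sizes counts pairs `(a, b)`. For fixed `a` and `b`, the admissible `ω` lie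
in one class of `r ⊓ s ⊓ t`, hence contribute at most `1 / |t-class of a|`; and `b` ranges over that
`t`-class. -/
theorem Setoid.sum_classCard_ratio_le (r s t : Setoid Ω) :
    ∑ ω, (((r ⊓ t).classCard ω : ℝ) * (s ⊓ t).classCard ω) *
      (((r ⊓ s ⊓ t).classCard ω : ℝ)⁻¹ * (t.classCard ω : ℝ)⁻¹) ≤ Fintype.card Ω := by
  classical
  have hcard : ∀ (u : Setoid Ω) (ω : Ω), (u.classCard ω : ℝ) = ∑ a, if u ω a then (1 : ℝ) else 0 := by
    intro u ω
    simp [Setoid.classCard]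
  calc ∑ ω, (((r ⊓ t).classCard ω : ℝ) * (s ⊓ t).classCard ω) *
      (((r ⊓ s ⊓ t).classCard ω : ℝ)⁻¹ * (t.classCard ω : ℝ)⁻¹)
      = ∑ ω, ∑ a, ∑ b, (if (r ⊓ t) ω a ∧ (s ⊓ t) ω b then
          ((r ⊓ s ⊓ t).classCard ω : ℝ)⁻¹ * (t.classCard ω : ℝ)⁻¹ else 0) := by
        refine Finset.sum_congr rfl fun ω _ => ?_
        rw [hcard (r ⊓ t), hcard (s ⊓ t), Finset.sum_mul_sum, Finset.sum_mul]
        refine Finset.sum_congr rfl fun a _ => ?_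
        rw [Finset.sum_mul]
        refine Finset.sum_congr rfl fun b _ => ?_
        by_cases h1 : (r ⊓ t) ω a <;> by_cases h2 : (s ⊓ t) ω b <;> simp [h1, h2]
    _ = ∑ a, ∑ b, ∑ ω, (if (r ⊓ t) ω a ∧ (s ⊓ t) ω b then
          ((r ⊓ s ⊓ t).classCard ω : ℝ)⁻¹ * (t.classCard ω : ℝ)⁻¹ else 0) := by
        rw [Finset.sum_comm]
        refine Finset.sum_congr rfl fun a _ => ?_
        rw [Finset.sum_comm]
    _ ≤ ∑ a, ∑ b, if t a b then (t.classCard a : ℝ)⁻¹ else 0 := by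
        refine Finset.sum_le_sum fun a _ => Finset.sum_le_sum fun b _ => ?_
        by_cases hab : t a b
        · rw [if_pos hab]
          calc _ = (∑ ω, if (r ⊓ t) ω a ∧ (s ⊓ t) ω b then
                ((r ⊓ s ⊓ t).classCard ω : ℝ)⁻¹ else 0) * (t.classCard a : ℝ)⁻¹ := by
                rw [Finset.sum_mul]
                refine Finset.sum_congr rfl fun ω _ => ?_
                by_cases h : (r ⊓ t) ω a ∧ (s ⊓ t) ω b
                · rw [if_pos h, if_pos h, t.classCard_congr (h.1.2)]
                · rw [if_neg h, if_neg h, zero_mul]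
            _ ≤ 1 * (t.classCard a : ℝ)⁻¹ := by
                refine mul_le_mul_of_nonneg_right ?_ (by positivity)
                refine Setoid.sum_ite_inv_classCard_le (r ⊓ s ⊓ t) _ ?_
                rintro ω ω' ⟨⟨h1, h2⟩, h3, h4⟩ ⟨⟨h1', h2'⟩, h3', h4'⟩
                exact ⟨⟨r.trans h1 (r.symm h1'), s.trans h3 (s.symm h3')⟩,
                  t.trans h2 (t.symm h2')⟩
            _ = _ := one_mul _
        · rw [if_neg hab]
          refine (Finset.sum_eq_zero fun ω _ => if_neg ?_).le
          rintro ⟨⟨_, h2⟩, _, h4⟩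
          exact hab (t.trans (t.symm h2) h4)
    _ = ∑ a : Ω, (1 : ℝ) := by
        refine Finset.sum_congr rfl fun a _ => ?_
        rw [← Finset.sum_filter, Finset.sum_const, nsmul_eq_mul]
        have hpos : (0 : ℝ) < t.classCard a := by exact_mod_cast t.classCard_pos a
        exact mul_inv_cancel₀ hpos.ne'
    _ = Fintype.card Ω := by simp

/-- Nonnegativity of the mutual information of `r` and `s` given `t`, from `log x ≤ x - 1` applied
to the ratio of class sizes. -/
theorem Setoid.entropy_submodular (r s t : Setoid Ω) :
    (r ⊓ s ⊓ t).entropy + t.entropy ≤ (r ⊓ t).entropy + (s ⊓ t).entropy := by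
  have hpos : ∀ (u : Setoid Ω) ω, (0 : ℝ) < u.classCard ω := fun u ω => by
    exact_mod_cast u.classCard_pos ω
  have key : ∑ ω, (Real.log ((r ⊓ t).classCard ω) + Real.log ((s ⊓ t).classCard ω)) ≤
      ∑ ω, (Real.log ((r ⊓ s ⊓ t).classCard ω) + Real.log (t.classCard ω)) := by
    have h1 : ∀ ω, (Real.log ((r ⊓ t).classCard ω) + Real.log ((s ⊓ t).classCard ω)) -
        (Real.log ((r ⊓ s ⊓ t).classCard ω) + Real.log (t.classCard ω)) ≤
        (((r ⊓ t).classCard ω : ℝ) * (s ⊓ t).classCard ω) *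
      (((r ⊓ s ⊓ t).classCard ω : ℝ)⁻¹ * (t.classCard ω : ℝ)⁻¹) - 1 := by
      intro ω
      have a1 := hpos (r ⊓ t) ω
      have a2 := hpos (s ⊓ t) ω
      have a3 := hpos (r ⊓ s ⊓ t) ω
      have a4 := hpos t ω
      have := Real.log_le_sub_one_of_pos (x := (((r ⊓ t).classCard ω : ℝ) * (s ⊓ t).classCard ω) *
        (((r ⊓ s ⊓ t).classCard ω : ℝ)⁻¹ * (t.classCard ω : ℝ)⁻¹)) (by positivity)
      rw [Real.log_mul (by positivity) (by positivity), Real.log_mul a1.ne' a2.ne',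
        Real.log_mul (by positivity) (by positivity), Real.log_inv, Real.log_inv] at this
      linarith
    have h2 := Finset.sum_le_sum fun ω (_ : ω ∈ Finset.univ) => h1 ω
    rw [Finset.sum_sub_distrib, Finset.sum_sub_distrib] at h2
    have h3 := Setoid.sum_classCard_ratio_le r s t
    simp only [Finset.sum_const, Finset.card_univ, nsmul_eq_mul, mul_one] at h2
    linarith
  unfold Setoid.entropy
  rw [Finset.sum_add_distrib, Finset.sum_add_distrib] at key
  have := div_le_div_of_nonneg_right key (Nat.cast_nonneg (α := ℝ) (Fintype.card Ω))
  rw [add_div, add_div] at this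
  linarith

/-- The uniform distribution maximises entropy; again `log x ≤ x - 1`, now with the inverse class
sizes summing to at most the number of values. -/
theorem Setoid.entropy_ker_le [Nonempty Ω] {α : Type*} [Fintype α] [Nonempty α] (f : Ω → α) :
    (Setoid.ker f).entropy ≤ Real.log (Fintype.card α) := by
  classical
  have hpos : ∀ ω, (0 : ℝ) < (Setoid.ker f).classCard ω := fun ω => by
    exact_mod_cast (Setoid.ker f).classCard_pos ω
  have hΩ : (0 : ℝ) < Fintype.card Ω := by exact_mod_cast Fintype.card_pos
  have hα : (0 : ℝ) < Fintype.card α := by exact_mod_cast Fintype.card_pos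
  have hsum : ∑ ω, ((Setoid.ker f).classCard ω : ℝ)⁻¹ ≤ Fintype.card α := by
    calc ∑ ω, ((Setoid.ker f).classCard ω : ℝ)⁻¹
        = ∑ a, ∑ ω, if f ω = a then ((Setoid.ker f).classCard ω : ℝ)⁻¹ else 0 := by
          rw [Finset.sum_comm]
          simp
      _ ≤ ∑ a : α, (1 : ℝ) := by
          refine Finset.sum_le_sum fun a _ => ?_
          refine Setoid.sum_ite_inv_classCard_le _ _ fun ω ω' h h' => ?_
          exact h.trans h'.symm
      _ = Fintype.card α := by simp
  have h1 : ∀ ω, Real.log (Fintype.card Ω) - Real.log ((Setoid.ker f).classCard ω) -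
      Real.log (Fintype.card α) ≤
      (Fintype.card Ω : ℝ) / Fintype.card α * ((Setoid.ker f).classCard ω : ℝ)⁻¹ - 1 := by
    intro ω
    have a1 := hpos ω
    have := Real.log_le_sub_one_of_pos (x := (Fintype.card Ω : ℝ) / Fintype.card α *
      ((Setoid.ker f).classCard ω : ℝ)⁻¹) (by positivity)
    rw [Real.log_mul (by positivity) (by positivity), Real.log_div hΩ.ne' hα.ne',
      Real.log_inv] at this
    linarith
  have h2 := Finset.sum_le_sum fun ω (_ : ω ∈ Finset.univ) => h1 ω
  rw [Finset.sum_sub_distrib, Finset.sum_sub_distrib, Finset.sum_sub_distrib,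
    ← Finset.mul_sum] at h2
  simp only [Finset.sum_const, Finset.card_univ, nsmul_eq_mul, mul_one] at h2
  have h3 : (Fintype.card Ω : ℝ) / Fintype.card α * ∑ ω, ((Setoid.ker f).classCard ω : ℝ)⁻¹ ≤
      Fintype.card Ω := by
    calc _ ≤ (Fintype.card Ω : ℝ) / Fintype.card α * Fintype.card α := by gcongr
      _ = _ := by field_simp
  unfold Setoid.entropy
  rw [sub_le_iff_le_add, ← sub_le_iff_le_add', le_div_iff₀ hΩ]
  linarith

/-- Conditional subadditivity of the entropy. -/
theorem Setoid.entropy_finset_inf_le {κ : Type*} (S : Finset κ)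
    (X : κ → Setoid Ω) (t : Setoid Ω) :
    (S.inf X ⊓ t).entropy - t.entropy ≤ ∑ k ∈ S, ((X k ⊓ t).entropy - t.entropy) := by
  classical
  induction S using Finset.induction_on with
  | empty => simp
  | insert a S ha ih =>
    rw [Finset.sum_insert ha, Finset.inf_insert]
    have := Setoid.entropy_submodular (X a) (S.inf X) t
    linarith

end PartitionEntropy

/-! ### Entropy of a set of independent uniform coordinates -/

section AgreeOn

variable {ι B : Type*}

/-- Two assignments are equivalent if they agree on `U`. -/
def agreeOn (B : Type*) (U : Finset ι) : Setoid (ι → B) where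
  r v v' := ∀ p ∈ U, v p = v' p
  iseqv := ⟨fun _ _ _ => rfl, fun h p hp => (h p hp).symm,
    fun h h' p hp => (h p hp).trans (h' p hp)⟩

theorem agreeOn_anti {U V : Finset ι} (h : U ⊆ V) : agreeOn B V ≤ agreeOn B U :=
  fun _ _ hv p hp => hv p (h hp)

theorem agreeOn_union [DecidableEq ι] (U V : Finset ι) :
    agreeOn B (U ∪ V) = agreeOn B U ⊓ agreeOn B V := by
  refine le_antisymm (le_inf (agreeOn_anti Finset.subset_union_left)
    (agreeOn_anti Finset.subset_union_right)) ?_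
  rintro v v' ⟨h1, h2⟩ p hp
  rcases Finset.mem_union.1 hp with hp | hp
  · exact h1 p hp
  · exact h2 p hp

theorem entropy_agreeOn [Fintype ι] [DecidableEq ι] [Fintype B] [Nonempty B] (U : Finset ι) :
    (agreeOn B U).entropy = U.card * Real.log (Fintype.card B) := by
  classical
  have hcc : ∀ v, (agreeOn B U).classCard v = Fintype.card B ^ (Uᶜ).card := by
    intro v
    have : (Finset.univ.filter fun v' => agreeOn B U v v') =
        Fintype.piFinset fun p => if p ∈ U then {v p} else Finset.univ := by
      ext v'
      simp only [Finset.mem_filter, Finset.mem_univ, true_and, Fintype.mem_piFinset]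
      refine ⟨fun h p => ?_, fun h p hp => ?_⟩
      · by_cases hp : p ∈ U
        · simpa [hp] using (h p hp).symm
        · simp [hp]
      · simpa [hp, eq_comm] using h p
    rw [Setoid.classCard, this, Fintype.card_piFinset, ← Finset.prod_mul_prod_compl U,
      Finset.prod_congr rfl (g := fun _ => 1), Finset.prod_congr rfl (s₁ := Uᶜ)
      (g := fun _ => Fintype.card B)]
    · simp
    · intro p hp
      simp [Finset.mem_compl.1 hp]
    · intro p hp
      simp [hp]
  have hpos : ((Fintype.card B : ℝ) ^ Fintype.card ι) ≠ 0 := by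
    have : (0 : ℝ) < Fintype.card B := by exact_mod_cast Fintype.card_pos
    positivity
  have hc : (Uᶜ).card + U.card = Fintype.card ι := by
    rw [add_comm, Finset.card_add_card_compl]
  unfold Setoid.entropy
  simp only [hcc, Finset.sum_const, Finset.card_univ, Fintype.card_fun, nsmul_eq_mul,
    Nat.cast_pow, Real.log_pow]
  rw [mul_div_assoc, mul_div_cancel₀ _ hpos, ← hc]
  push_cast
  ring

end AgreeOn

/-! ### The entropy converse -/

section Converse

variable {κ ν B : Type*} [Fintype κ] [DecidableEq κ] [Fintype ν] [DecidableEq ν]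

/-- The index pairs needed or computed by the nodes in `R`. -/
def knownPairs (C : κ → Finset (κ × ν)) (R : Finset κ) : Finset (κ × ν) :=
  Finset.univ.filter fun p => p.1 ∈ R ∨ ∃ k ∈ R, p ∈ C k

/-- The inverse number of nodes that compute an index pair. -/
noncomputable def invMultiplicity (C : κ → Finset (κ × ν)) (p : κ × ν) : ℝ :=
  ((Finset.univ.filter fun k => p ∈ C k).card : ℝ)⁻¹

/-- The sum of the inverse multiplicities of the pairs outside `knownPairs C Sᶜ` that their own
node does not compute. -/
noncomputable def exclusiveWeight (C : κ → Finset (κ × ν)) (S : Finset κ) : ℝ :=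
  ∑ p, if p ∉ knownPairs C Sᶜ ∧ p ∉ C p.1 then invMultiplicity C p else 0

theorem mem_knownPairs {C : κ → Finset (κ × ν)} {R : Finset κ} {p : κ × ν} :
    p ∈ knownPairs C R ↔ p.1 ∈ R ∨ ∃ k ∈ R, p ∈ C k := by
  simp [knownPairs]

omit [Fintype ν] in
theorem invMultiplicity_nonneg (C : κ → Finset (κ × ν)) (p : κ × ν) : 0 ≤ invMultiplicity C p := by
  unfold invMultiplicity; positivity

/-- Let a pair of weight `w` count for `S`, computed at `a` nodes, all in `S` and none its own node.
On the right it contributes `1` for its own node and `w` for each of the `|S| - 1 - a` other nodes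
not computing it: in total `(|S| - 1) w + 1 - a w`, and `a w ≤ 1`. -/
theorem exclusiveWeight_step (C : κ → Finset (κ × ν)) (S : Finset κ) :
    ((S.card : ℝ) - 1) * exclusiveWeight C S ≤
      ∑ k ∈ S, (((Finset.univ.filter fun p : κ × ν =>
        p.1 = k ∧ p ∉ knownPairs C Sᶜ ∧ p ∉ C p.1).card : ℝ) +
          exclusiveWeight C (S.erase k)) := by
  have hcard : ∀ k, (((Finset.univ.filter fun p : κ × ν =>
        p.1 = k ∧ p ∉ knownPairs C Sᶜ ∧ p ∉ C p.1).card : ℝ)) =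
      ∑ p : κ × ν, if p.1 = k ∧ p ∉ knownPairs C Sᶜ ∧ p ∉ C p.1 then (1 : ℝ) else 0 := by
    intro k; simp
  simp only [hcard, exclusiveWeight]
  simp only [← Finset.sum_add_distrib]
  rw [Finset.sum_comm, Finset.mul_sum]
  refine Finset.sum_le_sum fun p _ => ?_
  have hw := invMultiplicity_nonneg C p
  by_cases hp : p ∉ knownPairs C Sᶜ ∧ p ∉ C p.1
  · rw [if_pos hp]
    have hp' := hp
    rw [mem_knownPairs] at hp
    push Not at hp
    obtain ⟨⟨h1, h2⟩, h3⟩ := hp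
    have h1 : p.1 ∈ S := by simpa using h1
    have h2 : ∀ k, p ∈ C k → k ∈ S := fun k hk => by
      by_contra hkS
      exact h2 k (by simpa using hkS) hk
    have hterm : ∀ k ∈ S, ((if p.1 = k ∧ p ∉ knownPairs C Sᶜ ∧ p ∉ C p.1 then (1 : ℝ) else 0) +
        if p ∉ knownPairs C (S.erase k)ᶜ ∧ p ∉ C p.1 then invMultiplicity C p else 0) =
        (if p.1 = k then 1 - invMultiplicity C p else 0) + (invMultiplicity C p -
          if p ∈ C k then invMultiplicity C p else 0) := by
      intro k hk
      have hiff : (p ∉ knownPairs C (S.erase k)ᶜ ∧ p ∉ C p.1) ↔ (p.1 ≠ k ∧ p ∉ C k) := by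
        rw [mem_knownPairs]
        push Not
        constructor
        · rintro ⟨⟨a, b⟩, _⟩
          refine ⟨?_, b k (by simp)⟩
          rintro rfl
          simp at a
        · rintro ⟨a, b⟩
          refine ⟨⟨by simp [a, h1], fun j hj hpj => ?_⟩, h3⟩
          have := h2 j hpj
          have hjk : j ≠ k := by
            rintro rfl
            exact b hpj
          simp [hjk, this] at hj
      simp only [hiff, and_iff_left hp']
      by_cases hk1 : p.1 = k
      · have : p ∉ C k := hk1 ▸ h3
        simp [hk1, this]
      · by_cases hk2 : p ∈ C k <;> simp [hk1, hk2]
    rw [Finset.sum_congr rfl hterm, Finset.sum_add_distrib, Finset.sum_sub_distrib,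
      Finset.sum_ite_eq, if_pos h1, Finset.sum_const, ← Finset.sum_filter, Finset.sum_const,
      nsmul_eq_mul, nsmul_eq_mul]
    have hA : S.filter (fun k => p ∈ C k) = Finset.univ.filter fun k => p ∈ C k := by
      ext k
      simpa using h2 k
    have : ((S.filter (fun k => p ∈ C k)).card : ℝ) * invMultiplicity C p ≤ 1 := by
      rw [hA]
      exact mul_inv_le_one
    linarith
  · rw [if_neg hp, mul_zero]
    refine Finset.sum_nonneg fun k _ => ?_
    split_ifs <;> positivity

variable [Fintype B] [Nonempty B]

/-- Induction on `|S|`: given what the nodes outside `S` know, the signals still carry this much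
entropy. Subadditivity over `S` yields `(|S| - 1) H(X | Y) ≥ ∑ k ∈ S, H(X | X k, Y)`, and each
summand is bounded through the case `S.erase k`. -/
theorem exclusiveWeight_le_entropy (C : κ → Finset (κ × ν)) (X : κ → Setoid (κ × ν → B))
    (hX : ∀ k, agreeOn B (C k) ≤ X k)
    (hdec : ∀ k, agreeOn B (C k) ⊓ Finset.univ.inf X ≤
      agreeOn B (Finset.univ.filter fun p : κ × ν => p.1 = k)) (S : Finset κ) :
    exclusiveWeight C S * Real.log (Fintype.card B) ≤
      (Finset.univ.inf X ⊓ agreeOn B (knownPairs C Sᶜ)).entropy -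
        (agreeOn B (knownPairs C Sᶜ)).entropy := by
  induction hn : S.card using Nat.strong_induction_on generalizing S with
  | _ n ih =>
  have hlog : 0 ≤ Real.log (Fintype.card B) := Real.log_natCast_nonneg _
  set Y := agreeOn B (knownPairs C Sᶜ) with hY
  set XX := Finset.univ.inf X with hXX
  have hXle : ∀ k, XX ≤ X k := fun k => Finset.inf_le (Finset.mem_univ k)
  rcases Nat.lt_or_ge S.card 2 with hs | hs
  · have : exclusiveWeight C S ≤ 0 := by
      refine Finset.sum_nonpos fun p _ => ?_
      by_cases hp : p ∉ knownPairs C Sᶜ ∧ p ∉ C p.1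
      · rw [if_pos hp]
        rw [mem_knownPairs] at hp
        push Not at hp
        obtain ⟨⟨h1, h2⟩, h3⟩ := hp
        have h1 : p.1 ∈ S := by simpa using h1
        have : (Finset.univ.filter fun k => p ∈ C k) = ∅ := by
          refine Finset.filter_eq_empty_iff.2 fun k _ hk => ?_
          by_cases hkS : k ∈ S
          · have := Finset.card_le_one.1 (Nat.lt_succ_iff.1 hs) _ hkS _ h1
            exact h3 (this ▸ hk)
          · exact h2 k (by simpa using hkS) hk
        -- No node computes such a pair, and its weight is `0⁻¹ = 0`.
        simp [invMultiplicity, this]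
      · rw [if_neg hp]
    have h2 : Y.entropy ≤ (XX ⊓ Y).entropy := Setoid.entropy_anti inf_le_right
    nlinarith
  -- This is `H(X | C k, Y) ≤ H(X | X k, Y)`, as `X k` is a function of `C k`.
  have hcond : ∀ k ∈ S, (XX ⊓ agreeOn B (C k) ⊓ Y).entropy - (agreeOn B (C k) ⊓ Y).entropy ≤
      (XX ⊓ Y).entropy - (X k ⊓ Y).entropy := by
    intro k _
    have := Setoid.entropy_submodular XX (agreeOn B (C k)) (X k ⊓ Y)
    have e1 : XX ⊓ agreeOn B (C k) ⊓ (X k ⊓ Y) = XX ⊓ agreeOn B (C k) ⊓ Y := by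
      rw [← inf_assoc, inf_eq_left.2 (inf_le_right.trans (hX k))]
    have e2 : XX ⊓ (X k ⊓ Y) = XX ⊓ Y := by rw [← inf_assoc, inf_eq_left.2 (hXle k)]
    have e3 : agreeOn B (C k) ⊓ (X k ⊓ Y) = agreeOn B (C k) ⊓ Y := by
      rw [← inf_assoc, inf_eq_left.2 (hX k)]
    rw [e1, e2, e3] at this
    linarith
  have hsub := Setoid.entropy_finset_inf_le S X Y
  -- Signals from outside `S` are determined by `Y`.
  have hinf : S.inf X ⊓ Y = XX ⊓ Y := by
    refine le_antisymm (le_inf (Finset.le_inf fun k _ => ?_) inf_le_right)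
      (inf_le_inf_right _ (Finset.inf_mono (Finset.subset_univ S)))
    by_cases hk : k ∈ S
    · exact inf_le_left.trans (Finset.inf_le hk)
    · refine inf_le_right.trans ((agreeOn_anti fun p hp => ?_).trans (hX k))
      exact mem_knownPairs.2 (Or.inr ⟨k, by simpa using hk, hp⟩)
  rw [hinf] at hsub
  -- By `hdec`, the signals and `C k` determine the IVAs wanted by `k`. Adjoining these turns the
  -- conditioning into that of `S.erase k`, and those that are new contribute the cardinality.
  have hstep : ∀ k ∈ S, ((Finset.univ.filter fun p : κ × ν =>
        p.1 = k ∧ p ∉ knownPairs C Sᶜ ∧ p ∉ C p.1).card : ℝ) * Real.log (Fintype.card B) +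
          exclusiveWeight C (S.erase k) * Real.log (Fintype.card B) ≤
      (XX ⊓ agreeOn B (C k) ⊓ Y).entropy - (agreeOn B (C k) ⊓ Y).entropy := by
    intro k hk
    have h1 := ih (S.erase k).card (by rw [← hn]; exact Finset.card_erase_lt_of_mem hk)
      (S.erase k) rfl
    have hunion : knownPairs C (S.erase k)ᶜ =
        C k ∪ knownPairs C Sᶜ ∪ Finset.univ.filter fun p : κ × ν => p.1 = k := by
      ext p
      simp only [mem_knownPairs, Finset.mem_union, Finset.mem_filter, Finset.mem_univ, true_and,
        Finset.mem_compl, Finset.mem_erase, not_and_or, not_not]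
      constructor
      · rintro ((h | h) | ⟨j, h | h, hj⟩)
        · exact Or.inr h
        · exact Or.inl (Or.inr (Or.inl h))
        · exact Or.inl (Or.inl (h ▸ hj))
        · exact Or.inl (Or.inr (Or.inr ⟨j, h, hj⟩))
      · rintro ((h | h | ⟨j, h, hj⟩) | h)
        · exact Or.inr ⟨k, Or.inl rfl, h⟩
        · exact Or.inl (Or.inr h)
        · exact Or.inr ⟨j, Or.inr h, hj⟩
        · exact Or.inl (Or.inl h)
    have hXe : XX ⊓ agreeOn B (knownPairs C (S.erase k)ᶜ) = XX ⊓ agreeOn B (C k) ⊓ Y := by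
      rw [hunion, agreeOn_union, agreeOn_union, ← inf_assoc, ← inf_assoc]
      refine inf_eq_left.2 (le_trans ?_ (hdec k))
      exact inf_le_left.trans (le_of_eq (inf_comm _ _))
    have hdiff : (agreeOn B (knownPairs C (S.erase k)ᶜ)).entropy -
        (agreeOn B (C k) ⊓ Y).entropy = ((Finset.univ.filter fun p : κ × ν =>
        p.1 = k ∧ p ∉ knownPairs C Sᶜ ∧ p ∉ C p.1).card : ℝ) * Real.log (Fintype.card B) := by
      rw [hY, ← agreeOn_union, entropy_agreeOn, entropy_agreeOn, ← sub_mul]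
      congr 1
      have : knownPairs C (S.erase k)ᶜ = (C k ∪ knownPairs C Sᶜ) ∪ (Finset.univ.filter
          fun p : κ × ν => p.1 = k ∧ p ∉ knownPairs C Sᶜ ∧ p ∉ C p.1) := by
        rw [hunion]
        ext p
        simp only [Finset.mem_union, Finset.mem_filter, Finset.mem_univ, true_and]
        by_cases hpk : p.1 = k
        · rw [hpk]; tauto
        · tauto
      rw [this, Finset.card_union_of_disjoint]
      · push_cast; ring
      · rw [Finset.disjoint_left]
        intro p hp hp'
        simp only [Finset.mem_union, Finset.mem_filter, Finset.mem_univ, true_and] at hp hp'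
        obtain ⟨rfl, h2, h3⟩ := hp'
        tauto
    rw [hXe] at h1
    linarith
  have hsum := (Finset.sum_le_sum hstep).trans (Finset.sum_le_sum hcond)
  rw [Finset.sum_sub_distrib, Finset.sum_const, nsmul_eq_mul] at hsum
  rw [Finset.sum_sub_distrib, Finset.sum_const, nsmul_eq_mul] at hsub
  have hw := mul_le_mul_of_nonneg_right (exclusiveWeight_step C S) hlog
  simp only [← add_mul, ← Finset.sum_mul] at hsum
  have hs' : (0 : ℝ) < (S.card : ℝ) - 1 := by
    have : (2 : ℝ) ≤ S.card := by exact_mod_cast hs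
    linarith
  refine le_of_mul_le_mul_left ?_ hs'
  linarith

theorem sum_invMultiplicity_le_entropy (C : κ → Finset (κ × ν)) (X : κ → Setoid (κ × ν → B))
    (hX : ∀ k, agreeOn B (C k) ≤ X k)
    (hdec : ∀ k, agreeOn B (C k) ⊓ Finset.univ.inf X ≤
      agreeOn B (Finset.univ.filter fun p : κ × ν => p.1 = k)) :
    (∑ p, if p ∉ C p.1 then invMultiplicity C p else 0) * Real.log (Fintype.card B) ≤
      ∑ k, (X k).entropy := by
  have h := exclusiveWeight_le_entropy C X hX hdec Finset.univ
  have hK : knownPairs C (Finset.univ : Finset κ)ᶜ = ∅ := by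
    ext p
    simp [mem_knownPairs]
  have htop : agreeOn B (∅ : Finset (κ × ν)) = ⊤ := by
    refine eq_top_iff.2 fun v v' _ p hp => ?_
    simp at hp
  have h0 := entropy_agreeOn (B := B) (∅ : Finset (κ × ν))
  have hsub := Setoid.entropy_finset_inf_le Finset.univ X ⊤
  rw [htop] at h0
  simp only [Finset.card_empty, Nat.cast_zero, zero_mul] at h0
  simp only [inf_top_eq, h0, sub_zero] at hsub
  simp only [exclusiveWeight, hK, htop, h0, inf_top_eq, sub_zero, Finset.notMem_empty,
    not_false_eq_true, true_and] at h
  exact h.trans hsub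

end Converse

/-! ### Linear lower bounds for a single procedure -/

namespace Procedure

variable {K N T : ℕ}

theorem Decodes.sum_invMultiplicity_le {P : Procedure K N T} (hP : P.Decodes) :
    (∑ p, if p ∉ P.computed p.1 then invMultiplicity P.computed p else 0) * T ≤
      ∑ k, (P.len k : ℝ) := by
  have hlog2 : 0 < Real.log 2 := Real.log_pos (by norm_num)
  let X : Fin K → Setoid (Fin K × Fin N → Bits T) :=
    fun k => Setoid.ker fun v => P.signal (Function.curry v) k
  have h := sum_invMultiplicity_le_entropy P.computed X ?_ ?_
  · have hent : ∀ k, (X k).entropy ≤ P.len k * Real.log 2 := by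
      intro k
      refine (Setoid.entropy_ker_le _).trans (le_of_eq ?_)
      simp [ZMod.card]
    have h2 := h.trans (Finset.sum_le_sum fun k _ => hent k)
    have hB : Real.log (Fintype.card (Bits T)) = T * Real.log 2 := by
      simp [ZMod.card]
    rw [hB, ← Finset.sum_mul, ← mul_assoc] at h2
    exact le_of_mul_le_mul_right h2 hlog2
  · intro k v v' hv
    exact signal_congr fun p hp => hv p hp
  · rintro k v v' ⟨h1, h2⟩ p hp
    have hpk : p.1 = k := by simpa using hp
    have := hP.eq_of_agree (v := Function.curry v) (v' := Function.curry v') (k := k)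
      (fun p hp => h1 p hp) (fun i => ?_)
    · have := congrFun this p.2
      rw [← hpk] at this
      exact this
    · exact (Finset.inf_le (f := X) (Finset.mem_univ i)) h2

/-- Every IVA is computed at some node. -/
theorem Decodes.exists_mem_computed {P : Procedure K N T} (hP : P.Decodes) (hT : 1 ≤ T)
    (p : Fin K × Fin N) : ∃ k, p ∈ P.computed k := by
  classical
  by_contra! h
  have hne : (1 : Bits T) ≠ 0 := fun h0 => by
    have := congrFun h0 ⟨0, hT⟩
    simp at this
  -- Switching on one IVA that nobody computes changes no observation.
  let v : Fin K → Fin N → Bits T := fun q n => if (q, n) = p then 1 else 0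
  have hagree : ∀ k, ∀ p' ∈ P.computed k, v p'.1 p'.2 = (0 : Fin K → Fin N → Bits T) p'.1 p'.2 := by
    intro k p' hp'
    have : p' ≠ p := by
      rintro rfl
      exact h k hp'
    simp [v, this]
  have := hP.eq_of_agree (hagree p.1) fun i => signal_congr (hagree i)
  have := congrFun this p.2
  simp [v, hne] at this

/-- An affine lower bound for the contribution of every index pair gives one for the load. Here `a`
is the number of nodes that compute the IVA and `m` the number of nodes that store the file. -/
theorem Decodes.le_sum_len {P : Procedure K N T} (hP : P.Decodes) (hK : 1 ≤ K) (hT : 1 ≤ T)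
    (α β γ δ θ : ℝ) (hpair : ∀ (a m : ℕ), 1 ≤ a → a ≤ m → m ≤ K →
      α + (β + θ * (m : ℝ)⁻¹) + γ * a + δ * m ≤ 0 ∧
      α + γ * a + δ * m ≤ (a : ℝ)⁻¹) :
    (α * (N * K) + (β * (∑ k, ((P.store k).card : ℝ)) + θ * N) + γ * ∑ k, ((P.computed k).card : ℝ) +
      δ * (K * ∑ k, ((P.store k).card : ℝ))) * T ≤ ∑ k, (P.len k : ℝ) := by
  refine le_trans (mul_le_mul_of_nonneg_right ?_ (Nat.cast_nonneg T)) hP.sum_invMultiplicity_le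
  let m : Fin N → ℕ := fun n => (Finset.univ.filter fun k => n ∈ P.store k).card
  let a : Fin K × Fin N → ℕ := fun p => (Finset.univ.filter fun k => p ∈ P.computed k).card
  have hstore : ∑ k, ((P.store k).card : ℝ) =
      ∑ n, ∑ k, if n ∈ P.store k then (1 : ℝ) else 0 := by
    rw [Finset.sum_comm]
    simp
  have hstore' : ∑ k, ((P.store k).card : ℝ) = ∑ n, (m n : ℝ) := by
    rw [hstore]
    simp [m]
  have hcomp : ∑ k, ((P.computed k).card : ℝ) = ∑ p, (a p : ℝ) := by
    have : ∀ p, (a p : ℝ) = ∑ k, if p ∈ P.computed k then (1 : ℝ) else 0 := by simp [a]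
    simp only [this]
    rw [Finset.sum_comm]
    simp
  have e1 : ∑ p : Fin K × Fin N, α = α * (N * K) := by
    simp; ring
  have e2 : ∑ p : Fin K × Fin N, (if p.2 ∈ P.store p.1 then β else 0) =
      β * ∑ k, ((P.store k).card : ℝ) := by
    rw [hstore, Fintype.sum_prod_type, Finset.sum_comm]
    simp only [Finset.mul_sum, mul_ite, mul_one, mul_zero]
  have ha : ∀ p, 1 ≤ a p := fun p => by
    obtain ⟨k, hk⟩ := hP.exists_mem_computed hT p
    exact Finset.card_pos.2 ⟨k, by simpa using hk⟩
  have ham : ∀ p, a p ≤ m p.2 := fun p => by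
    refine Finset.card_le_card fun k hk => ?_
    simp only [Finset.mem_filter, Finset.mem_univ, true_and] at hk ⊢
    exact (mem_computed.1 hk).1
  -- The `m n` nodes that store file `n` contribute `θ / m n` each.
  have e4 : ∑ p : Fin K × Fin N, (if p.2 ∈ P.store p.1 then θ * (m p.2 : ℝ)⁻¹ else 0) =
      θ * N := by
    rw [Fintype.sum_prod_type, Finset.sum_comm, Finset.sum_congr rfl (g := fun _ => θ)]
    · simp [mul_comm]
    · intro n _
      have hm : (0 : ℝ) < m n := by
        exact_mod_cast (ha (⟨0, hK⟩, n)).trans (ham (⟨0, hK⟩, n))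
      rw [← Finset.sum_filter]
      dsimp only
      rw [Finset.sum_const, nsmul_eq_mul]
      change (m n : ℝ) * _ = θ
      field_simp
  have e3 : ∑ p : Fin K × Fin N, δ * (m p.2 : ℝ) = δ * (K * ∑ k, ((P.store k).card : ℝ)) := by
    rw [hstore', Fintype.sum_prod_type]
    simp only [← Finset.mul_sum]
    simp
  rw [hcomp, ← e1, ← e2, ← e3, ← e4, Finset.mul_sum, ← Finset.sum_add_distrib,
    ← Finset.sum_add_distrib, ← Finset.sum_add_distrib, ← Finset.sum_add_distrib]
  refine Finset.sum_le_sum fun p _ => ?_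
  have hmK : m p.2 ≤ K := (Finset.card_le_univ _).trans (by simp)
  obtain ⟨h1, h2⟩ := hpair (a p) (m p.2) (ha p) (ham p) hmK
  by_cases hs : p.2 ∈ P.store p.1
  · rw [if_pos hs, if_pos hs]
    refine h1.trans ?_
    split_ifs
    · exact le_rfl
    · exact invMultiplicity_nonneg _ _
  · have : p ∉ P.computed p.1 := fun h => hs (mem_computed.1 h).1
    rw [if_neg hs, if_neg hs, if_pos this, add_zero, add_zero]
    exact h2

end Procedure

/-! ### Asymptotic achievability and time sharing -/

theorem achievable_iff {K F T : ℕ} (hK : 1 ≤ K) (hT : 1 ≤ T) {r c L : ℝ} :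
    Achievable K F T r c L ↔ ∀ ε : ℝ, 0 < ε → ∃ N₀ : ℕ, ∀ N : ℕ, N₀ ≤ N →
      ∃ s' c' l' : ℕ, Realizable K T N s' c' l' ∧ (s' : ℝ) ≤ N * (r + ε) ∧
        (c' : ℝ) ≤ N * K * (c + ε) ∧ (l' : ℝ) ≤ N * K * T * (L + ε) := by
  have hK' : (0 : ℝ) < K := by exact_mod_cast hK
  have hT' : (0 : ℝ) < T := by exact_mod_cast hT
  refine forall₂_congr fun ε _ => ⟨?_, ?_⟩
  · rintro ⟨N₀, h⟩
    refine ⟨max N₀ 1, fun N hN => ?_⟩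
    have hN' : (0 : ℝ) < N := by exact_mod_cast (le_max_right _ _).trans hN
    obtain ⟨P, hP, h1, h2, h3⟩ := h N ((le_max_left _ _).trans hN)
    refine ⟨_, _, _, ⟨P, hP.decodes, rfl, rfl, rfl⟩, ?_, ?_, ?_⟩
    · rw [Procedure.storageSpace, div_le_iff₀' hN'] at h1
      exact_mod_cast h1
    · rw [Procedure.computationLoad, div_le_iff₀' (by positivity)] at h2
      exact_mod_cast h2
    · rw [Procedure.communicationLoad, div_le_iff₀' (by positivity)] at h3
      exact_mod_cast h3
  · rintro ⟨N₀, h⟩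
    refine ⟨max N₀ 1, fun N hN => ?_⟩
    have hN' : (0 : ℝ) < N := by exact_mod_cast (le_max_right _ _).trans hN
    obtain ⟨_, _, _, ⟨P, hP, rfl, rfl, rfl⟩, h1, h2, h3⟩ := h N ((le_max_left _ _).trans hN)
    refine ⟨P, hP.isValid F, ?_, ?_, ?_⟩
    · rw [Procedure.storageSpace, div_le_iff₀' hN']
      exact_mod_cast h1
    · rw [Procedure.computationLoad, div_le_iff₀' (by positivity)]
      exact_mod_cast h2
    · rw [Procedure.communicationLoad, div_le_iff₀' (by positivity)]
      exact_mod_cast h3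

theorem Achievable.mono {K F T : ℕ} {r c L r' c' L' : ℝ} (h : Achievable K F T r c L)
    (hr : r ≤ r') (hc : c ≤ c') (hL : L ≤ L') : Achievable K F T r' c' L' := fun ε hε =>
  (h ε hε).imp fun _ hN₀ N hN => by
    obtain ⟨P, hP, h1, h2, h3⟩ := hN₀ N hN
    exact ⟨P, hP, by linarith, by linarith, by linarith⟩

/-- The remainder of the division of the number of files by `N₀` is treated without communication. -/
theorem Realizable.achievable {K T N₀ s c l : ℕ} (F : ℕ) (hK : 1 ≤ K) (hT : 1 ≤ T)
    (hN₀ : 0 < N₀) (h : Realizable K T N₀ s c l) :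
    Achievable K F T (s / N₀) (c / (N₀ * K)) (l / (N₀ * K * T)) := by
  have hK' : (0 : ℝ) < K := by exact_mod_cast hK
  have hT' : (0 : ℝ) < T := by exact_mod_cast hT
  have hN' : (0 : ℝ) < N₀ := by exact_mod_cast hN₀
  rw [achievable_iff hK hT]
  intro ε hε
  -- Fewer than `N₀` leftover files cost at most `N₀ * K` stored files and computed IVAs.
  obtain ⟨N₁, hN₁⟩ := exists_nat_ge (N₀ * K / ε)
  refine ⟨N₁, fun N hN => ⟨_, _, _, by
    simpa only [mul_comm (N / N₀), Nat.div_add_mod] using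
      (h.mul (N / N₀)).add (realizable_no_communication K T (N % N₀)), ?_⟩⟩
  have hNN : (N₀ * K : ℝ) ≤ N * ε := by
    rw [← div_le_iff₀ hε]
    exact hN₁.trans (by exact_mod_cast hN)
  have hq : ((N / N₀ : ℕ) : ℝ) ≤ N / N₀ := Nat.cast_div_le
  have hrem : ((N % N₀ : ℕ) : ℝ) ≤ N₀ := by exact_mod_cast (Nat.mod_lt N hN₀).le
  have hremK : ((N % N₀ : ℕ) : ℝ) * K ≤ N * ε :=
    (mul_le_mul_of_nonneg_right hrem hK'.le).trans hNN
  have hpos : 0 ≤ (N : ℝ) * ε := by positivity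
  have hone : (1 : ℝ) ≤ K := by exact_mod_cast hK
  push_cast
  refine ⟨?_, ?_, ?_⟩
  · have := mul_le_mul_of_nonneg_left hq (Nat.cast_nonneg (α := ℝ) s)
    have e : (s : ℝ) * (N / N₀) = N * (s / N₀) := by ring
    linarith
  · have := mul_le_mul_of_nonneg_left hq (Nat.cast_nonneg (α := ℝ) c)
    have e : (c : ℝ) * (N / N₀) = N * K * (c / (N₀ * K)) := by field_simp
    have : (N : ℝ) * ε * 1 ≤ N * ε * K := mul_le_mul_of_nonneg_left hone hpos
    linarith
  · have := mul_le_mul_of_nonneg_left hq (Nat.cast_nonneg (α := ℝ) l)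
    have e : (l : ℝ) * (N / N₀) = N * K * T * (l / (N₀ * K * T)) := by field_simp
    have : 0 ≤ (N : ℝ) * K * T * ε := by positivity
    linarith

theorem achievable_of_le {K T m t : ℕ} (F : ℕ) (hT : 1 ≤ T) (ht : 1 ≤ t) (htm : t ≤ m)
    (hmK : m ≤ K) :
    Achievable K F T m (m / K + (1 - m / K) * t) ((1 - m / K) / t) := by
  have hK : 1 ≤ K := (ht.trans htm).trans hmK
  have hK' : (0 : ℝ) < K := by exact_mod_cast hK
  have hT' : (0 : ℝ) < T := by exact_mod_cast hT
  have ht' : (0 : ℝ) < t := by exact_mod_cast ht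
  have hA : (0 : ℝ) < Fintype.card (Equiv.Perm (Fin K)) := by exact_mod_cast Fintype.card_pos
  have hpos : 0 < Fintype.card (Equiv.Perm (Fin K) × Fin t) := by
    rw [Fintype.card_prod, Fintype.card_fin]
    exact Nat.mul_pos Fintype.card_pos ht
  refine ((realizable_of_le T htm hmK).achievable F hK hT hpos).mono (le_of_eq ?_) (le_of_eq ?_)
    (le_of_eq ?_)
  all_goals
    simp only [Fintype.card_prod, Fintype.card_fin]
    push_cast [Nat.cast_sub hmK]
    field_simp

/-- Time sharing: a fraction `a` of the files is treated by one family of procedures, the others by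
another one. -/
theorem Achievable.convex_combination {K F T : ℕ} (hK : 1 ≤ K) (hT : 1 ≤ T)
    {r₁ c₁ L₁ r₂ c₂ L₂ a b : ℝ} (h₁ : Achievable K F T r₁ c₁ L₁) (h₂ : Achievable K F T r₂ c₂ L₂)
    (ha : 0 ≤ a) (hb : 0 ≤ b) (hab : a + b = 1) :
    Achievable K F T (a * r₁ + b * r₂) (a * c₁ + b * c₂) (a * L₁ + b * L₂) := by
  rcases ha.eq_or_lt with rfl | ha
  · obtain rfl : b = 1 := by linarith
    simpa using h₂
  rcases hb.eq_or_lt with rfl | hb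
  · obtain rfl : a = 1 := by linarith
    simpa using h₁
  have hK' : (0 : ℝ) < K := by exact_mod_cast hK
  have hT' : (0 : ℝ) < T := by exact_mod_cast hT
  rw [achievable_iff hK hT] at *
  intro ε hε
  obtain ⟨N₁, hN₁⟩ := h₁ (ε / 2) (by positivity)
  obtain ⟨N₂, hN₂⟩ := h₂ (ε / 2) (by positivity)
  -- Rounding `N * a` down moves less than one file from one family to the other, which costs at
  -- most `M`; the other half of `ε` absorbs it.
  set M := max |r₂ - r₁| (max |c₂ - c₁| |L₂ - L₁|) with hM
  obtain ⟨N₃, hN₃⟩ := exists_nat_ge ((N₁ + 1) / a + N₂ / b + M / (ε / 2))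
  refine ⟨N₃, fun N hN => ?_⟩
  have hM0 : 0 ≤ M := (abs_nonneg _).trans (le_max_left _ _)
  have hNbig := hN₃.trans (Nat.cast_le (α := ℝ).2 hN)
  have p1 : 0 ≤ ((N₁ : ℝ) + 1) / a := by positivity
  have p2 : 0 ≤ (N₂ : ℝ) / b := by positivity
  have p3 : 0 ≤ M / (ε / 2) := by positivity
  have b1 : (N₁ : ℝ) + 1 ≤ N * a := by rw [← div_le_iff₀ ha]; linarith
  have b2 : (N₂ : ℝ) ≤ N * b := by rw [← div_le_iff₀ hb]; linarith
  have b3 : M ≤ N * (ε / 2) := by rw [← div_le_iff₀ (by positivity)]; linarith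
  set n₁ := ⌊(N : ℝ) * a⌋₊ with hn₁
  have f1 : (n₁ : ℝ) ≤ N * a := Nat.floor_le (by positivity)
  have f2 : (N : ℝ) * a < n₁ + 1 := Nat.lt_floor_add_one _
  have hb' : b = 1 - a := by linarith
  have hle : n₁ ≤ N := by
    have : (n₁ : ℝ) ≤ N := f1.trans (by nlinarith [Nat.cast_nonneg (α := ℝ) N])
    exact_mod_cast this
  obtain ⟨n₂, hn₂⟩ := Nat.exists_eq_add_of_le hle
  have hsum : (N : ℝ) = n₁ + n₂ := by exact_mod_cast hn₂
  have g1 : N₁ ≤ n₁ := by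
    have : (N₁ : ℝ) < n₁ + 1 := by linarith
    exact Nat.lt_succ_iff.1 (by exact_mod_cast this)
  have g2 : N₂ ≤ n₂ := by
    have : (N₂ : ℝ) ≤ n₂ := by
      rw [hb'] at b2
      linarith
    exact_mod_cast this
  obtain ⟨s, c, l, hR, i1, i2, i3⟩ := hN₁ n₁ g1
  obtain ⟨s', c', l', hR', j1, j2, j3⟩ := hN₂ n₂ g2
  have main : ∀ x y : ℝ, |y - x| ≤ M →
      n₁ * (x + ε / 2) + n₂ * (y + ε / 2) ≤ N * (a * x + b * y + ε) := by
    intro x y hxy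
    have hd : (N * a - n₁) * (y - x) ≤ M := by
      refine (le_abs_self _).trans ?_
      rw [abs_mul, abs_of_nonneg (by linarith : (0 : ℝ) ≤ N * a - n₁)]
      nlinarith [abs_nonneg (y - x)]
    have hn₂' : (n₂ : ℝ) = N - n₁ := by linarith
    rw [hn₂', hb']
    nlinarith
  have m1 := main r₁ r₂ (le_max_left _ _)
  have m2 := main c₁ c₂ ((le_max_left _ _).trans (le_max_right _ _))
  have m3 := main L₁ L₂ ((le_max_right _ _).trans (le_max_right _ _))
  refine ⟨_, _, _, hn₂ ▸ hR.add hR', ?_, ?_, ?_⟩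
  · push_cast
    linarith
  · push_cast
    have := mul_le_mul_of_nonneg_right m2 hK'.le
    linarith
  · push_cast
    have := mul_le_mul_of_nonneg_right m3 (by positivity : (0 : ℝ) ≤ K * T)
    linarith

/-! ### Affine lower bounds for the achievable region -/

theorem Achievable.affine_le {K F T : ℕ} (hK : 1 ≤ K) (hT : 1 ≤ T) {r c L : ℝ}
    (h : Achievable K F T r c L) (α β γ δ θ : ℝ) (hβ : β / K + δ ≤ 0) (hγ : γ ≤ 0)
    (hpair : ∀ (a m : ℕ), 1 ≤ a → a ≤ m → m ≤ K →
      α + (β + θ * (m : ℝ)⁻¹) + γ * a + δ * m ≤ 0 ∧ α + γ * a + δ * m ≤ (a : ℝ)⁻¹) :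
    α + (β / K + δ) * r + θ / K + γ * c ≤ L := by
  have hK' : (0 : ℝ) < K := by exact_mod_cast hK
  have hT' : (0 : ℝ) < T := by exact_mod_cast hT
  refine le_of_forall_pos_le_add fun η hη => ?_
  -- Slack `η / D` in load, storage and computation, weighted by `1`, `-(β / K + δ)` and `-γ`, adds
  -- up to `η`.
  set D := 1 - (β / K + δ) - γ with hD
  have hDpos : 0 < D := by linarith
  obtain ⟨N₀, hN₀⟩ := h (η / D) (by positivity)
  obtain ⟨P, hP, h1, h2, h3⟩ := hN₀ (max N₀ 1) (le_max_left _ _)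
  have hN' : (0 : ℝ) < (max N₀ 1 : ℕ) := by exact_mod_cast le_max_right N₀ 1
  have key := hP.decodes.le_sum_len hK hT α β γ δ θ hpair
  have hcomm : α + (β / K + δ) * P.storageSpace + θ / K + γ * P.computationLoad ≤
      P.communicationLoad := by
    unfold Procedure.storageSpace Procedure.computationLoad Procedure.communicationLoad
    rw [le_div_iff₀ (by positivity)]
    refine le_trans (le_of_eq ?_) key
    field_simp
    ring
  have k1 := mul_le_mul_of_nonpos_left h1 hβ
  have k2 := mul_le_mul_of_nonpos_left h2 hγ
  have : η / D * D = η := div_mul_cancel₀ _ hDpos.ne'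
  rw [hD] at this
  linarith

/-- The affine function of `c` that interpolates the corner loads for `g` and `g + 1`. -/
noncomputable def chordLoad (K : ℕ) (r : ℝ) (g : ℕ) (c : ℝ) : ℝ :=
  ((2 * g + 1) - 2 * g * r / K - c) / (g * (g + 1))

theorem Achievable.chordLoad_le {K F T : ℕ} (hK : 1 ≤ K) (hT : 1 ≤ T) {r c L : ℝ}
    (h : Achievable K F T r c L) {g : ℕ} (hg : 1 ≤ g) : chordLoad K r g c ≤ L := by
  have hK' : (0 : ℝ) < K := by exact_mod_cast hK
  have hg' : (0 : ℝ) < g := by exact_mod_cast hg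
  set D : ℝ := g * (g + 1) with hD
  have hDpos : 0 < D := by positivity
  -- The line `(2g + 1 - a) / D` interpolates `1 / a` at `g` and `g + 1`; `β` lowers it to `(1 - a)
  -- / D ≤ 0` for pairs whose own node stores the file.
  have := h.affine_le hK hT ((2 * g + 1) / D) (-(2 * g) / D) (-1 / D) 0 0 ?_ ?_ ?_
  · refine le_trans (le_of_eq ?_) this
    unfold chordLoad
    rw [← hD]
    field_simp
    ring
  · rw [neg_div, neg_div, add_zero, neg_nonpos]
    positivity
  · rw [neg_div, neg_nonpos]
    positivity
  · intro a m ha _ _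
    have ha' : (1 : ℝ) ≤ a := by exact_mod_cast ha
    constructor
    · have : (2 * g + 1) / D + (-(2 * g) / D + 0 * (m : ℝ)⁻¹) + -1 / D * a + 0 * m =
          (1 - a) / D := by ring
      rw [this]
      exact div_nonpos_of_nonpos_of_nonneg (by linarith) hDpos.le
    · have : (2 * g + 1) / D + -1 / D * a + 0 * m = (2 * g + 1 - a) / D := by ring
      rw [this, inv_eq_one_div, div_le_div_iff₀ hDpos (by linarith)]
      -- No integer lies strictly between `g` and `g + 1`.
      have hint : (0 : ℝ) ≤ ((a : ℝ) - g) * (a - g - 1) := by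
        rcases le_or_gt a g with hag | hag
        · have : (a : ℝ) ≤ g := by exact_mod_cast hag
          nlinarith
        · have : (g : ℝ) + 1 ≤ a := by exact_mod_cast hag
          nlinarith
      rw [hD]
      nlinarith

theorem Achievable.storage_bound {K F T : ℕ} (hK : 1 ≤ K) (hT : 1 ≤ T) {r c L : ℝ}
    (h : Achievable K F T r c L) {f : ℕ} (hf : 1 ≤ f) :
    (2 * f + 1 - r) / (f * (f + 1)) - 1 / K ≤ L := by
  have hf' : (0 : ℝ) < f := by exact_mod_cast hf
  set D : ℝ := f * (f + 1) with hD
  have hDpos : 0 < D := by positivity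
  -- The interpolating line is now taken in `m`, using `1 / m ≤ 1 / a`; `θ = -1` removes `1 / m` at
  -- each storing node and yields the term `-1 / K`.
  have := h.affine_le hK hT ((2 * f + 1) / D) 0 0 (-1 / D) (-1) ?_ le_rfl ?_
  · refine le_trans (le_of_eq ?_) this
    ring
  · rw [zero_div, zero_add, neg_div, neg_nonpos]
    positivity
  · intro a m ha ham _
    have ha' : (1 : ℝ) ≤ a := by exact_mod_cast ha
    have ham' : (a : ℝ) ≤ m := by exact_mod_cast ham
    have hm : (2 * f + 1) / D + -1 / D * m ≤ (m : ℝ)⁻¹ := by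
      have : (2 * f + 1) / D + -1 / D * m = (2 * f + 1 - m) / D := by ring
      rw [this, inv_eq_one_div, div_le_div_iff₀ hDpos (by linarith)]
      have hint : (0 : ℝ) ≤ ((m : ℝ) - f) * (m - f - 1) := by
        rcases le_or_gt m f with hag | hag
        · have : (m : ℝ) ≤ f := by exact_mod_cast hag
          nlinarith
        · have : (f : ℝ) + 1 ≤ m := by exact_mod_cast hag
          nlinarith
      rw [hD]
      nlinarith
    have hinv : (m : ℝ)⁻¹ ≤ (a : ℝ)⁻¹ := inv_anti₀ (by linarith) ham'
    constructor <;> linarith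

theorem cornerLoad_loadPoint {K : ℕ} {r g : ℝ} (hrK : r < K) (hK : (0 : ℝ) < K) :
    cornerLoad K r (loadPoint K r g) = (1 - r / K) / g := by
  have h : 1 - r / K ≠ 0 := by
    rw [Ne, sub_eq_zero, eq_comm, div_eq_one_iff_eq hK.ne']
    exact hrK.ne
  unfold cornerLoad loadPoint
  rw [add_sub_cancel_left, one_div, mul_inv, pow_two, div_eq_mul_inv]
  field_simp

/-! ### Corner points in terms of `⌊r⌋` -/

section Floor

variable {K f : ℕ} {r : ℝ}

/-- For integral `r` the formulas with `f + 1` in place of `⌈r⌉` remain correct, so the later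
identities need no case distinction in their statements. -/
theorem ceil_eq_or_of_floor_eq (hfloor : ⌊r⌋ = f) :
    (r = f ∧ (⌈r⌉ : ℝ) = f) ∨ (⌈r⌉ : ℝ) = f + 1 := by
  have h1 : (f : ℝ) ≤ r := by exact_mod_cast hfloor ▸ Int.floor_le r
  have h2 : r < f + 1 := by exact_mod_cast hfloor ▸ Int.lt_floor_add_one r
  rcases h1.eq_or_lt with h | h
  · left
    refine ⟨h.symm, ?_⟩
    rw [← h]
    simp
  · right
    have : ⌈r⌉ = (f : ℤ) + 1 := by
      rw [Int.ceil_eq_iff]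
      push_cast
      constructor <;> linarith
    rw [this]
    push_cast
    rfl

theorem LStar_eq_of_floor_eq (hf : 1 ≤ f) (hfloor : ⌊r⌋ = f) :
    LStar K r = (2 * f + 1 - r) / (f * (f + 1)) - 1 / K := by
  have hf' : (0 : ℝ) < f := by exact_mod_cast hf
  unfold LStar
  rw [hfloor, Int.cast_natCast]
  rcases ceil_eq_or_of_floor_eq hfloor with ⟨h, hc⟩ | hc
  · rw [hc, h]
    field_simp
    ring
  · rw [hc]
    ring

theorem cStar_eq_of_floor_eq (hrK : r < K) (hK : (0 : ℝ) < K) (hfloor : ⌊r⌋ = f) :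
    cStar K r = loadPoint K r f + (r - f) * (1 - (f + 1) / K) := by
  have h : (K : ℝ) - r ≠ 0 := by linarith
  unfold cStar gStar loadPoint
  rw [hfloor, Int.cast_natCast]
  rcases ceil_eq_or_of_floor_eq hfloor with ⟨h, hc⟩ | hc
  · rw [hc, h]
    ring
  · rw [hc]
    field_simp
    ring

/-- For fixed `t = g`, both loads are affine in `m`, so sharing between `f` and `f + 1` replaces `m`
by `r`. -/
theorem achievable_loadPoint {T g : ℕ} (F : ℕ) (hT : 1 ≤ T) (hrK : r < K) (hfloor : ⌊r⌋ = f)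
    (hg : 1 ≤ g) (hgf : g ≤ f) : Achievable K F T r (loadPoint K r g) ((1 - r / K) / g) := by
  have h1 : (f : ℝ) ≤ r := by exact_mod_cast hfloor ▸ Int.floor_le r
  have h2 : r < f + 1 := by exact_mod_cast hfloor ▸ Int.lt_floor_add_one r
  have hfK : f < K := by exact_mod_cast h1.trans_lt hrK
  have hK : 1 ≤ K := by omega
  have := (achievable_of_le F hT hg hgf hfK.le).convex_combination hK hT
    (achievable_of_le F hT hg (hgf.trans f.le_succ) hfK) (a := f + 1 - r) (b := r - f)
    (by linarith) (by linarith) (by ring)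
  refine this.mono (le_of_eq ?_) (le_of_eq ?_) (le_of_eq ?_)
  · push_cast; ring
  · unfold loadPoint; push_cast; ring
  · push_cast; ring

/-- Sharing between `f` and `f + 1` with `t = m`: each storing node computes all the IVAs missing
elsewhere. -/
theorem achievable_cStar {T : ℕ} (F : ℕ) (hT : 1 ≤ T) (hrK : r < K) (hfloor : ⌊r⌋ = f)
    (hf : 1 ≤ f) : Achievable K F T r (cStar K r) (LStar K r) := by
  have h1 : (f : ℝ) ≤ r := by exact_mod_cast hfloor ▸ Int.floor_le r
  have h2 : r < f + 1 := by exact_mod_cast hfloor ▸ Int.lt_floor_add_one r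
  have hfK : f < K := by exact_mod_cast h1.trans_lt hrK
  have hK : 1 ≤ K := by omega
  have hK' : (0 : ℝ) < K := by exact_mod_cast hK
  have hf' : (0 : ℝ) < f := by exact_mod_cast hf
  have := (achievable_of_le F hT hf le_rfl hfK.le).convex_combination hK hT
    (achievable_of_le F hT (hf.trans f.le_succ) le_rfl hfK) (a := f + 1 - r) (b := r - f)
    (by linarith) (by linarith) (by ring)
  refine this.mono (le_of_eq ?_) (le_of_eq ?_) (le_of_eq ?_)
  · push_cast; ring
  · rw [cStar_eq_of_floor_eq hrK hK' hfloor]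
    unfold loadPoint
    push_cast
    ring
  · rw [LStar_eq_of_floor_eq hf hfloor]
    push_cast
    field_simp
    ring

theorem chordLoad_cStar (hrK : r < K) (hf : 1 ≤ f) (hfloor : ⌊r⌋ = f) (hK : (0 : ℝ) < K) :
    chordLoad K r f (cStar K r) = LStar K r := by
  have hf' : (0 : ℝ) < f := by exact_mod_cast hf
  rw [cStar_eq_of_floor_eq hrK hK hfloor, LStar_eq_of_floor_eq hf hfloor]
  unfold chordLoad loadPoint
  field_simp
  ring

end Floor

/-! ### Chords and the lower convex envelope -/

section Chord

variable {K : ℕ} {r : ℝ} {g : ℕ}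

theorem chordLoad_loadPoint (hK : (0 : ℝ) < K) (hg : 1 ≤ g) :
    chordLoad K r g (loadPoint K r g) = (1 - r / K) / g := by
  have hg' : (0 : ℝ) < g := by exact_mod_cast hg
  unfold chordLoad loadPoint
  field_simp
  ring

theorem chordLoad_loadPoint_succ (hK : (0 : ℝ) < K) (hg : 1 ≤ g) :
    chordLoad K r g (loadPoint K r (g + 1 : ℕ)) = (1 - r / K) / (g + 1 : ℕ) := by
  have hg' : (0 : ℝ) < g := by exact_mod_cast hg
  unfold chordLoad loadPoint
  push_cast
  field_simp
  ring

theorem chordLoad_convex_combination (x y : ℝ) {a b : ℝ} (hab : a + b = 1) :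
    chordLoad K r g (a * x + b * y) = a * chordLoad K r g x + b * chordLoad K r g y := by
  obtain rfl : b = 1 - a := by linarith
  unfold chordLoad
  ring

/-- If a chord supports an achievable set of points and touches it at two points, the optimal load
and the envelope coincide with the chord in between. -/
theorem optimalLoad_eq_lowerConvexEnvelope_of_chord {F T : ℕ} (hK : 1 ≤ K) (hT : 1 ≤ T)
    (hg : 1 ≤ g) {A : Set (ℝ × ℝ)} (hA : ∀ p ∈ A, Achievable K F T r p.1 p.2) {p q : ℝ × ℝ}
    (hp : p ∈ A) (hq : q ∈ A) (hpc : chordLoad K r g p.1 = p.2)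
    (hqc : chordLoad K r g q.1 = q.2) {c : ℝ} (h1 : p.1 ≤ c) (h2 : c ≤ q.1) :
    optimalLoad K F T r c = lowerConvexEnvelope A c := by
  have hseg : c ∈ segment ℝ p.1 q.1 := by
    rw [segment_eq_Icc (h1.trans h2)]
    exact ⟨h1, h2⟩
  obtain ⟨a, b, ha, hb, hab, rfl⟩ := hseg
  simp only [smul_eq_mul] at *
  have hc := chordLoad_convex_combination (K := K) (r := r) (g := g) p.1 q.1 hab
  rw [hpc, hqc] at hc
  have hopt : IsLeast {L : ℝ | Achievable K F T r (a * p.1 + b * q.1) L}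
      (chordLoad K r g (a * p.1 + b * q.1)) := by
    refine ⟨?_, fun L hL => Achievable.chordLoad_le hK hT hL hg⟩
    have := (hA p hp).convex_combination hK hT (hA q hq) ha hb hab
    rw [Set.mem_ofPred_eq, hc]
    exact this.mono (le_of_eq (by rw [← add_mul, hab, one_mul])) le_rfl le_rfl
  have henv : IsLeast {y : ℝ | (a * p.1 + b * q.1, y) ∈ convexHull ℝ A}
      (chordLoad K r g (a * p.1 + b * q.1)) := by
    constructor
    · rw [Set.mem_ofPred_eq, hc]
      exact convex_convexHull ℝ A (subset_convexHull ℝ A hp) (subset_convexHull ℝ A hq) ha hb hab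
    · intro y hy
      -- The points of `A` are achievable, hence above the chord, and a half-plane is convex.
      have hsub : convexHull ℝ A ⊆ {z : ℝ × ℝ | chordLoad K r g z.1 ≤ z.2} := by
        refine convexHull_min (fun z hz => (hA z hz).chordLoad_le hK hT hg) ?_
        intro z hz w hw s t hs ht hst
        simp only [Set.mem_ofPred_eq, Prod.fst_add, Prod.smul_fst, Prod.snd_add, Prod.smul_snd,
          smul_eq_mul] at hz hw ⊢
        rw [chordLoad_convex_combination _ _ hst]
        gcongr
      exact hsub hy
  rw [optimalLoad, lowerConvexEnvelope, hopt.csInf_eq, henv.csInf_eq]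

end Chord

/-! ### The optimal load -/

theorem theorem1 (K F T : ℕ) (hT : 1 ≤ T) (r : ℝ) (hr1 : 1 ≤ r) (hrK : r < K) :
    -- the infimum that defines the optimal load is a genuine one
    (∀ c : ℝ, 1 ≤ c → c ≤ r →
      {L : ℝ | Achievable K F T r c L}.Nonempty ∧ BddBelow {L : ℝ | Achievable K F T r c L}) ∧
    (∀ g : ℕ, 1 ≤ g → (g : ℤ) ≤ ⌊r⌋ → ∀ c : ℝ, c = r / K + (1 - r / K) * g →
      optimalLoad K F T r c = 1 / (c - r / K) * (1 - r / K) ^ 2) ∧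
    (∀ c : ℝ, 1 ≤ c → c ≤ cStar K r →
      optimalLoad K F T r c =
        lowerConvexEnvelope (cornerPoints K r ∪ {(cStar K r, LStar K r)}) c) ∧
    (∀ c : ℝ, cStar K r ≤ c → c ≤ r → optimalLoad K F T r c = LStar K r) := by
  have hK' : (0 : ℝ) < K := by linarith
  have hK : 1 ≤ K := by exact_mod_cast hK'
  obtain ⟨f, hfloor⟩ : ∃ f : ℕ, ⌊r⌋ = f :=
    ⟨⌊r⌋.toNat, (Int.toNat_of_nonneg (Int.floor_nonneg.2 (by linarith))).symm⟩
  have hf : 1 ≤ f := by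
    have : (1 : ℤ) ≤ ⌊r⌋ := Int.le_floor.2 (by simpa using hr1)
    rw [hfloor] at this
    exact_mod_cast this
  have hpos : 0 < 1 - r / K := by
    rw [sub_pos, div_lt_one hK']
    exact hrK
  have hone : loadPoint K r (1 : ℕ) = 1 := by simp [loadPoint]
  refine ⟨fun c hc _ => ⟨⟨(1 - r / K) / (1 : ℕ), ?_⟩, ⟨chordLoad K r 1 c, fun L hL => ?_⟩⟩, ?_, ?_, ?_⟩
  · exact (achievable_loadPoint F hT hrK hfloor le_rfl hf).mono le_rfl (hone.trans_le hc) le_rfl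
  · exact Achievable.chordLoad_le hK hT hL le_rfl
  · rintro g hg hgf c rfl
    rw [hfloor, Nat.cast_le] at hgf
    have h : IsLeast {L : ℝ | Achievable K F T r (loadPoint K r g) L} ((1 - r / K) / g) := by
      refine ⟨achievable_loadPoint F hT hrK hfloor hg hgf, fun L hL => ?_⟩
      rw [← chordLoad_loadPoint hK' hg]
      exact Achievable.chordLoad_le hK hT hL hg
    exact h.csInf_eq.trans (cornerLoad_loadPoint hrK hK').symm
  · intro c hc hcs
    have hmem : ∀ g : ℕ, 1 ≤ g → g ≤ f → ((loadPoint K r g, (1 - r / K) / g) : ℝ × ℝ) ∈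
        cornerPoints K r ∪ {(cStar K r, LStar K r)} := by
      refine fun g hg hgf => Or.inl ⟨g, hg, ?_, ?_⟩
      · rw [hfloor]
        exact_mod_cast hgf
      · rw [cornerLoad_loadPoint hrK hK']
    have hA : ∀ p ∈ cornerPoints K r ∪ {(cStar K r, LStar K r)}, Achievable K F T r p.1 p.2 := by
      rintro p (⟨g, hg, hgf, rfl⟩ | rfl)
      · rw [hfloor, Nat.cast_le] at hgf
        simpa only [cornerLoad_loadPoint hrK hK'] using
          achievable_loadPoint F hT hrK hfloor hg hgf
      · exact achievable_cStar F hT hrK hfloor hf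
    rcases le_or_gt (loadPoint K r f) c with hcf | hcf
    · exact optimalLoad_eq_lowerConvexEnvelope_of_chord hK hT hf hA (hmem f hf le_rfl)
        (Or.inr rfl) (chordLoad_loadPoint hK' hf) (chordLoad_cStar hrK hf hfloor hK') hcf hcs
    -- `x` is the real parameter with `c = loadPoint K r x`; the supporting chord is the one from
    -- `⌊x⌋₊` to `⌊x⌋₊ + 1`.
    · set x := (c - r / K) / (1 - r / K) with hx
      have hcx : c = loadPoint K r x := by
        rw [loadPoint, hx, mul_div_cancel₀ _ hpos.ne', add_sub_cancel]
      have hmono : ∀ {y z : ℝ}, loadPoint K r y ≤ loadPoint K r z ↔ y ≤ z := by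
        intro y z
        rw [loadPoint, loadPoint, add_le_add_iff_left, mul_le_mul_iff_right₀ hpos]
      have hx1 : 1 ≤ x := by
        rw [← hmono, ← hcx]
        exact_mod_cast hone.trans_le hc
      have hxf : x < f := by
        rw [← not_le, ← hmono, ← hcx]
        exact not_le.2 hcf
      have hg : 1 ≤ ⌊x⌋₊ := Nat.le_floor (by exact_mod_cast hx1)
      have hgf : ⌊x⌋₊ + 1 ≤ f := (Nat.floor_lt (by linarith)).2 hxf
      refine optimalLoad_eq_lowerConvexEnvelope_of_chord hK hT hg hA
        (hmem _ hg ((Nat.le_succ _).trans hgf)) (hmem _ (hg.trans (Nat.le_succ _)) hgf)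
        (chordLoad_loadPoint hK' hg) (chordLoad_loadPoint_succ hK' hg) ?_ ?_
      · rw [hcx]
        exact hmono.2 (Nat.floor_le (by linarith))
      · rw [hcx]
        refine hmono.2 ?_
        push_cast
        exact (Nat.lt_floor_add_one x).le
  · intro c hc _
    have h : IsLeast {L : ℝ | Achievable K F T r c L} (LStar K r) := by
      refine ⟨(achievable_cStar F hT hrK hfloor hf).mono le_rfl hc le_rfl, fun L hL => ?_⟩
      rw [LStar_eq_of_floor_eq hf hfloor]
      exact Achievable.storage_bound hK hT hL hf
    exact h.csInf_eq
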